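/- Let $-\infty\le a<b\le\infty$ and let $p,q,r:(a,b)\to\mathbb R$ be Lebesgue measurable with $p>0$, $r>0$ a.e. and $1/p,\,q,\,r\in L^1_{\mathrm{loc}}((a,b);dx)$. Consider $$\ell=\frac1r\Big(-\frac{d}{dx}\,p\,\frac{d}{dx}+q\Big).$$ A solution $u$ of $\ell u=zu$, $z\in\mathbb C$, is a function with $u,\,pu'\in AC_{\mathrm{loc}}((a,b))$ satisfying the equation a.e. on $(a,b)$. Let $d\in\{a,b\}$ be an endpoint; "near $d$" means on some interval $[c,b)$ with $c\in(a,b)$ if $d=b$, and on some interval $(a,c]$ with $c\in(a,b)$ if $d=a$. * $\ell$ is nonoscillatory at $d$ if for some $\lambda\in\mathbb R$ every nontrivial real solution of $\ell u=\lambda u$ has finitely many zeros near $d$. * A Weyl–Titchmarsh solution of $\ell u=zu$ near $d$ is a nontrivial solution that is square integrable near $d$ with respect to $r\,dx$. $\ell$ is in the limit point case at $d$ if for $z\in\mathbb C\setminus\mathbb R$ (the choice of $z$ is immaterial) such a solution exists and is unique up to constant multiples. * A principal solution of $\ell u=\lambda u$, $\lambda\in\mathbb R$, at $d$ is a real-valued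 solution $u_d(\lambda,\cdot)$ that does not vanish on some interval $J$ of the form $[c,b)$ (if $d=b$), resp. $(a,c]$ (if $d=a$), $c\in(a,b)$, with $\int_J p(x)^{-1}u_d(\lambda,x)^{-2}\,dx=\infty$. * For $\Lambda\in\mathbb R$, an analytic Weyl–Titchmarsh family on $\mathbb C\setminus[\Lambda,\infty)$ near $d$ consists of nontrivial solutions $\psi(z,\cdot)$ of $\ell u=zu$, $z\in\mathbb C\setminus[\Lambda,\infty)$, that are Weyl–Titchmarsh solutions near $d$ for $z\in\mathbb C\setminus\mathbb R$ and such that $z\mapsto\psi(z,x)$ is analytic in $\mathbb C\setminus[\Lambda,\infty)$ for every $x\in(a,b)$. **Theorem 2.13.** If $\ell$ is nonoscillatory and in the limit point case at $d\in\{a,b\}$, then there exists $\lambda_d\in\mathbb R$ such that the following hold. (1) There is an analytic Weyl–Titchmarsh family on $\mathbb C\setminus[\lambda_d,\infty)$ near $d$, and for every such family $\psi$ and every real $\lambda<\lambda_d$, $\psi(\lambda,\cdot)$ is a Weyl–Titchmarsh solution of $\ell u=\lambda u$ near $d$. (2) For every real $\lambda<\lambda_d$ there is a principal solution of $\ell u=\lambda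 u$ at $d$. Moreover, for every Weyl–Titchmarsh solution $\psi(\lambda,\cdot)$ of $\ell u=\lambda u$ near $d$ (in particular, for the members at $\lambda$ of the families in (1)) and every principal solution $u_d(\lambda,\cdot)$ at $d$, $$\psi(\lambda,x)\,\psi(\lambda,x_0)^{-1}=u_d(\lambda,x)\,u_d(\lambda,x_0)^{-1}$$ for all $x,x_0\in(a,b)$ that lie to the right of all zeros (if $d=b$), resp. to the left of all zeros (if $d=a$), of $\psi(\lambda,\cdot)$ and $u_d(\lambda,\cdot)$ in $(a,b)$ (if any); and $\psi(\lambda,\cdot)$ is a nonzero constant multiple of $u_d(\lambda,\cdot)$ on $(a,b)$. -/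

import Mathlib

open MeasureTheory Set

/-- The data of a scalar Sturm–Liouville expression `ℓ = r⁻¹ (-(d/dx) p (d/dx) + q)` on an open
interval `(a, b)`, `-∞ ≤ a < b ≤ ∞`, with the standing assumptions on the coefficients
(only their values on `(a, b)` matter). -/
structure SturmLiouville where
  a : EReal
  b : EReal
  p : ℝ → ℝ
  q : ℝ → ℝ
  r : ℝ → ℝ
  a_lt_b : a < b
  aemeasurable_p : AEMeasurable p (volume.restrict {x : ℝ | a < x ∧ x < b})
  aemeasurable_q : AEMeasurable q (volume.restrict {x : ℝ | a < x ∧ x < b})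
  aemeasurable_r : AEMeasurable r (volume.restrict {x : ℝ | a < x ∧ x < b})
  p_pos : ∀ᵐ x ∂(volume.restrict {x : ℝ | a < x ∧ x < b}), 0 < p x
  r_pos : ∀ᵐ x ∂(volume.restrict {x : ℝ | a < x ∧ x < b}), 0 < r x
  locInt_p : LocallyIntegrableOn (fun x => 1 / p x) {x : ℝ | a < x ∧ x < b} volume
  locInt_q : LocallyIntegrableOn q {x : ℝ | a < x ∧ x < b} volume
  locInt_r : LocallyIntegrableOn r {x : ℝ | a < x ∧ x < b} volume

namespace SturmLiouville

/-- The two endpoints: `left` is `a`, `right` is `b`. -/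
inductive Endpoint where
  | left
  | right

/-- The open interval `(a, b)` as a set of real numbers. -/
def I (S : SturmLiouville) : Set ℝ := {x : ℝ | S.a < x ∧ x < S.b}

/-- The one-sided neighbourhood of an endpoint cut off at `c`:
`(a, c]` for the left endpoint, `[c, b)` for the right one. -/
def near (S : SturmLiouville) : Endpoint → ℝ → Set ℝ
  | .left, c => {x : ℝ | S.a < x ∧ x ≤ c}
  | .right, c => {x : ℝ | c ≤ x ∧ x < S.b}

/-- `x` lies strictly between `y` and the endpoint: to the left of `y` for the left endpoint,
to the right of `y` for the right one. -/
def Endpoint.Beyond : Endpoint → ℝ → ℝ → Prop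
  | .left, x, y => x < y
  | .right, x, y => y < x

/-- `f ∈ AC_loc((a, b))`. -/
def LocallyAC {𝕜 : Type*} [RCLike 𝕜] (S : SturmLiouville) (f : ℝ → 𝕜) : Prop :=
  ∀ x ∈ S.I, ∀ y ∈ S.I, AbsolutelyContinuousOnInterval f x y

/-- `u` solves `ℓ u = z u` on `(a, b)`: both `u` and `p u'` belong to `AC_loc((a, b))` and
`r⁻¹ (-(p u')' + q u) = z u` a.e. on `(a, b)`. The function `u₁` is the locally absolutely
continuous representative of `p u'`. For `𝕜 = ℝ` these are the real-valued solutions. -/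
def IsSolution {𝕜 : Type*} [RCLike 𝕜] (S : SturmLiouville) (z : 𝕜) (u : ℝ → 𝕜) : Prop :=
  S.LocallyAC u ∧ ∃ u₁ : ℝ → 𝕜, S.LocallyAC u₁ ∧
    (∀ᵐ x ∂(volume.restrict S.I), u₁ x = S.p x • deriv u x) ∧
    ∀ᵐ x ∂(volume.restrict S.I), (S.r x)⁻¹ • (-deriv u₁ x + S.q x • u x) = z * u x

/-- `u` does not vanish identically on `(a, b)`. -/
def Nontrivial {𝕜 : Type*} [RCLike 𝕜] (S : SturmLiouville) (u : ℝ → 𝕜) : Prop :=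
  ∃ x ∈ S.I, u x ≠ 0

/-- `ℓ` is nonoscillatory near the endpoint `d` for the parameter `t`: every nontrivial real
solution of `ℓ u = t u` has finitely many zeros near `d`. -/
def NonoscillatoryFor (S : SturmLiouville) (d : Endpoint) (t : ℝ) : Prop :=
  ∃ c ∈ S.I, ∀ u : ℝ → ℝ, S.IsSolution t u → S.Nontrivial u →
    {x : ℝ | x ∈ S.near d c ∧ u x = 0}.Finite

/-- `ℓ` is nonoscillatory at `d`: it is so for some real parameter. -/
def Nonoscillatory (S : SturmLiouville) (d : Endpoint) : Prop :=
  ∃ t : ℝ, S.NonoscillatoryFor d t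

/-- `u` is square integrable with respect to `r dx` near the endpoint `d`. -/
def L2Near (S : SturmLiouville) (d : Endpoint) (u : ℝ → ℂ) : Prop :=
  ∃ c ∈ S.I, IntegrableOn (fun x => ‖u x‖ ^ 2 * S.r x) (S.near d c) volume

/-- `ψ` is a (nontrivial) Weyl–Titchmarsh solution of `ℓ u = z u` near `d`. -/
def IsWeylTitchmarsh (S : SturmLiouville) (d : Endpoint) (z : ℂ) (ψ : ℝ → ℂ) : Prop :=
  S.IsSolution z ψ ∧ S.Nontrivial ψ ∧ S.L2Near d ψ

/-- `ℓ` is in the limit point case at `d`: for a nonreal `z` (the choice is immaterial), the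
solution of `ℓ u = z u` that is square integrable near `d` is unique up to constant multiples. -/
def LimitPoint (S : SturmLiouville) (d : Endpoint) : Prop :=
  ∃ z : ℂ, z.im ≠ 0 ∧ ∃ ψ : ℝ → ℂ, S.IsWeylTitchmarsh d z ψ ∧
    ∀ φ : ℝ → ℂ, S.IsSolution z φ → S.L2Near d φ → ∃ k : ℂ, ∀ x ∈ S.I, φ x = k * ψ x

/-- `u` is a (real-valued) principal solution of `ℓ u = t u` at `d`: it has no zero in a
neighbourhood of `d`, and `∫ p⁻¹ u⁻² dx` over this neighbourhood diverges. -/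
def IsPrincipal (S : SturmLiouville) (d : Endpoint) (t : ℝ) (u : ℝ → ℝ) : Prop :=
  S.IsSolution t u ∧ ∃ c ∈ S.I, (∀ x ∈ S.near d c, u x ≠ 0) ∧
    ∫⁻ x in S.near d c, ENNReal.ofReal (1 / (S.p x * u x ^ 2)) = ⊤

/-- The slit plane `ℂ \ [Λ, ∞)`. -/
def slit (Λ : ℝ) : Set ℂ := {z : ℂ | ¬ ∃ t : ℝ, Λ ≤ t ∧ z = (t : ℂ)}

/-- `ψ(z, ·)`, `z ∈ ℂ \ [Λ, ∞)`, is an analytic extension to real `z < Λ` of a family of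
Weyl–Titchmarsh solutions near `d`: all `ψ(z, ·)` are nontrivial solutions of `ℓ u = z u`, they are
Weyl–Titchmarsh solutions for nonreal `z`, and `ψ(·, x)` is analytic in `ℂ \ [Λ, ∞)` for each
fixed `x`. Square integrability is not required for real `z`. -/
def IsWeylFamily (S : SturmLiouville) (d : Endpoint) (Λ : ℝ) (ψ : ℂ → ℝ → ℂ) : Prop :=
  (∀ z ∈ slit Λ, S.IsSolution z (ψ z) ∧ S.Nontrivial (ψ z)) ∧
  (∀ z : ℂ, z.im ≠ 0 → S.IsWeylTitchmarsh d z (ψ z)) ∧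
  ∀ x ∈ S.I, DifferentiableOn ℂ (fun z => ψ z x) (slit Λ)

end SturmLiouville

/-!
Let `Λ` be a parameter for which `ℓ` is nonoscillatory at the endpoint; `Λ` itself serves as the
asserted number. By reflection the endpoint is the right one, `b`.

*Energy.* Some real solution `w` of `ℓ w = Λ w` has no zero in some `[c, b)`. For a solution `u` of
`ℓ u = z u` and `ζ = z - Λ`, the Wronskian `W = W(w, u) = p w² (u / w)'` satisfies
`W' = -ζ r w² (u / w)`, whence
`∫ |W|² / (p w²) - ζ ∫ r |u|² = [W · conj u / w]` on subintervals of `[c, b)`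
(`NonvanishingSol.energy_identity`). If `ζ ∉ [0, ∞)`, multiplication by `|ζ| - conj ζ` makes the
real parts of both coefficients on the left positive. Hence a nontrivial solution has at most one
zero in `[c, b)` (`NonvanishingSol.eq_zero_of_two_zeros`), and, if `φ(z, ·)` and `s(z, ·)` denote
the solutions normalized at `c`, both `M_y(z) = φ(z, y) / s(z, y)` and the norm of
`φ - M_y s` in `L²((c, y); r dx)` stay bounded as `y → b`, locally uniformly in `z`
(`NonvanishingSol.exists_weyl_bound`).

*Limit point case.* By Weyl's alternative (`IsSol.l2Near_of_forall`) it holds for all `z`, real ones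
included, that any two square integrable solutions are linearly dependent
(`LimitPoint.wronskian_eq_zero`). Every cluster point `m` of `M_y(z)` yields a square integrable
solution `φ - m s`, so there is only one cluster point, `M_y(z)` converges, and its limit `m(z)` is
holomorphic off `[Λ, ∞)` as a pointwise limit of locally bounded holomorphic functions
(`LimitPoint.exists_weyl_function`). The functions `ψ = φ - m s` form an analytic
Weyl–Titchmarsh family that is square integrable for real `z < Λ` too. Any other family is
`χ(z, x) = χ(z, c) ψ(z, x)` for nonreal `z`, and by continuity for real `z < Λ`.

*Principal solutions.* A square integrable real solution `u` is nonvanishing near `b`, and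
reduction of order gives `(g / u)' = const / (p u²)` for any other solution `g`. If
`∫ 1 / (p u²)` were finite, `g` would be `O(u)`, hence square integrable
(`NonvanishingSol.lintegral_eq_top`). If, conversely, `u` is principal and `g` square integrable and
not proportional to `u`, then `g / u → ∞`, and `u` would be square integrable as well
(`NonvanishingSol.W_eq_zero`). Both contradict the limit point case.

The solutions `φ(z, ·)`, `s(z, ·)` are entire in `z`: by variation of constants from two solutions
of `ℓ u = 0` they are governed by a system `Y' = z B Y` with locally integrable `B`, whose Picard
series is a power series in `z` (`LinearSystem.exists_solution`).
-/

/-! ### Primitives of locally integrable functions -/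

theorem AbsolutelyContinuousOnInterval.of_dist_le {X Y : Type*} [PseudoMetricSpace X]
    [PseudoMetricSpace Y] {f : ℝ → X} {g : ℝ → Y} {a b C : ℝ}
    (hf : AbsolutelyContinuousOnInterval f a b)
    (h : ∀ x ∈ uIcc a b, ∀ y ∈ uIcc a b, dist (g x) (g y) ≤ C * dist (f x) (f y)) :
    AbsolutelyContinuousOnInterval g a b := by
  unfold AbsolutelyContinuousOnInterval at hf ⊢
  refine squeeze_zero' (.of_forall fun E => Finset.sum_nonneg fun i _ => dist_nonneg) ?_
    (by simpa using hf.const_mul C)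
  rw [Filter.eventually_inf_principal]
  filter_upwards with E hE
  rw [Finset.mul_sum]
  exact Finset.sum_le_sum fun i hi => h _ (hE.1 i hi).1 _ (hE.1 i hi).2

namespace AbsolutelyContinuousOnInterval

variable {𝕜 : Type*} [RCLike 𝕜] {f : ℝ → 𝕜} {a b : ℝ}

theorem re (hf : AbsolutelyContinuousOnInterval f a b) :
    AbsolutelyContinuousOnInterval (fun x => RCLike.re (f x)) a b :=
  hf.of_dist_le (C := 1) fun x _ y _ => by
    rw [one_mul, dist_eq_norm, dist_eq_norm, ← map_sub, Real.norm_eq_abs]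
    exact RCLike.abs_re_le_norm _

theorem im (hf : AbsolutelyContinuousOnInterval f a b) :
    AbsolutelyContinuousOnInterval (fun x => RCLike.im (f x)) a b :=
  hf.of_dist_le (C := 1) fun x _ y _ => by
    rw [one_mul, dist_eq_norm, dist_eq_norm, ← map_sub, Real.norm_eq_abs]
    exact RCLike.abs_im_le_norm _

theorem ae_hasDerivAt (hf : AbsolutelyContinuousOnInterval f a b) :
    ∀ᵐ x, x ∈ uIcc a b → HasDerivAt f ((deriv (fun x => RCLike.re (f x)) x : ℝ) +
      (deriv (fun x => RCLike.im (f x)) x : ℝ) * RCLike.I) x := by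
  filter_upwards [hf.re.ae_differentiableAt, hf.im.ae_differentiableAt] with x h1 h2 hx
  have e1 := ((RCLike.ofRealCLM (K := 𝕜)).hasFDerivAt).comp_hasDerivAt x (h1 hx).hasDerivAt
  have e2 := ((RCLike.ofRealCLM (K := 𝕜)).hasFDerivAt).comp_hasDerivAt x (h2 hx).hasDerivAt
  have := e1.add (e2.mul_const (RCLike.I : 𝕜))
  convert! this using 1
  ext t
  simp [RCLike.re_add_im]

theorem intervalIntegrable_deriv' (hf : AbsolutelyContinuousOnInterval f a b) :
    IntervalIntegrable (deriv f) volume a b := by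
  have h1 : IntervalIntegrable (fun x => ((deriv (fun x => RCLike.re (f x)) x : ℝ) : 𝕜) +
      ((deriv (fun x => RCLike.im (f x)) x : ℝ) : 𝕜) * RCLike.I) volume a b := by
    have e1 := hf.re.intervalIntegrable_deriv
    have e2 := hf.im.intervalIntegrable_deriv
    rw [intervalIntegrable_iff] at *
    exact (RCLike.ofRealCLM (K := 𝕜)).integrable_comp e1 |>.add
      (((RCLike.ofRealCLM (K := 𝕜)).integrable_comp e2).mul_const _)
  refine h1.congr_ae ?_
  rw [Filter.EventuallyEq, ae_restrict_iff' measurableSet_uIoc]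
  filter_upwards [hf.ae_hasDerivAt] with x hx hx'
  exact (hx (uIoc_subset_uIcc hx')).deriv.symm

theorem of_integral {E : Type*} [NormedAddCommGroup E] [NormedSpace ℝ E] {f g : ℝ → E}
    (hg : IntervalIntegrable g volume a b)
    (h : ∀ x ∈ uIcc a b, ∀ y ∈ uIcc a b, ∫ t in x..y, g t = f y - f x) :
    AbsolutelyContinuousOnInterval f a b := by
  have hn := hg.norm.absolutelyContinuousOnInterval_intervalIntegral (c := a) left_mem_uIcc
  refine hn.of_dist_le (C := 1) fun x hx y hy => ?_
  have ha : ∀ x ∈ uIcc a b, IntervalIntegrable (fun t => ‖g t‖) volume a x := fun x hx =>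
    hg.norm.mono_set (uIcc_subset_uIcc left_mem_uIcc hx)
  rw [one_mul, dist_comm, dist_eq_norm, ← h x hx y hy, dist_comm, dist_eq_norm,
    intervalIntegral.integral_interval_sub_left (ha y hy) (ha x hx)]
  exact intervalIntegral.norm_integral_le_abs_integral_norm

theorem integral_deriv_eq_sub' (hf : AbsolutelyContinuousOnInterval f a b) :
    ∫ x in a..b, deriv f x = f b - f a := by
  have hi := hf.intervalIntegrable_deriv'
  have hF : AbsolutelyContinuousOnInterval (fun x => ∫ t in a..x, deriv f t) a b := by
    refine of_integral hi fun x hx y hy => ?_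
    have ha : ∀ x ∈ uIcc a b, IntervalIntegrable (deriv f) volume a x := fun x hx =>
      hi.mono_set (uIcc_subset_uIcc left_mem_uIcc hx)
    exact (intervalIntegral.integral_interval_sub_left (ha y hy) (ha x hx)).symm
  obtain ⟨C, hC⟩ := (hf.sub hF).const_of_ae_hasDerivAt_zero (by
    filter_upwards [hf.ae_hasDerivAt, hi.ae_hasDerivAt_integral] with x h1 h2 hx
    simpa using! (h1 hx).differentiableAt.hasDerivAt.sub (h2 hx a left_mem_uIcc))
  have h1 := hC a left_mem_uIcc
  have h2 := hC b right_mem_uIcc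
  simp only [Pi.sub_apply, intervalIntegral.integral_same, sub_zero] at h1 h2
  rw [h1, ← h2]; abel

end AbsolutelyContinuousOnInterval

/-- `f` is a primitive of the locally integrable function `g` on the set `s`: differences of values
of `f` are integrals of `g`. On an interval this says that `f` is locally absolutely continuous
with `f' = g` almost everywhere. -/
def IsPrimitiveOn {E : Type*} [NormedAddCommGroup E] [NormedSpace ℝ E] (f g : ℝ → E)
    (s : Set ℝ) : Prop :=
  ∀ x ∈ s, ∀ y ∈ s, IntervalIntegrable g volume x y ∧ ∫ t in x..y, g t = f y - f x

namespace IsPrimitiveOn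

section General

variable {E : Type*} [NormedAddCommGroup E] [NormedSpace ℝ E] {f g f' g' : ℝ → E} {s t : Set ℝ}

theorem mono (h : IsPrimitiveOn f f' s) (hst : t ⊆ s) : IsPrimitiveOn f f' t :=
  fun x hx y hy => h x (hst hx) y (hst hy)

theorem ac (h : IsPrimitiveOn f f' s) (hs : s.OrdConnected) {x y : ℝ} (hx : x ∈ s) (hy : y ∈ s) :
    AbsolutelyContinuousOnInterval f x y :=
  .of_integral (h x hx y hy).1 fun a ha b hb =>
    (h a (hs.uIcc_subset hx hy ha) b (hs.uIcc_subset hx hy hb)).2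

theorem continuousOn_uIcc (h : IsPrimitiveOn f f' s) (hs : s.OrdConnected) {x y : ℝ} (hx : x ∈ s)
    (hy : y ∈ s) : ContinuousOn f (uIcc x y) :=
  (h.ac hs hx hy).continuousOn

theorem add (hf : IsPrimitiveOn f f' s) (hg : IsPrimitiveOn g g' s) :
    IsPrimitiveOn (fun x => f x + g x) (fun x => f' x + g' x) s := fun x hx y hy => by
  obtain ⟨h1, h2⟩ := hf x hx y hy
  obtain ⟨h3, h4⟩ := hg x hx y hy
  refine ⟨h1.add h3, ?_⟩
  rw [intervalIntegral.integral_add h1 h3, h2, h4, add_sub_add_comm]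

theorem sub (hf : IsPrimitiveOn f f' s) (hg : IsPrimitiveOn g g' s) :
    IsPrimitiveOn (fun x => f x - g x) (fun x => f' x - g' x) s := fun x hx y hy => by
  obtain ⟨h1, h2⟩ := hf x hx y hy
  obtain ⟨h3, h4⟩ := hg x hx y hy
  refine ⟨h1.sub h3, ?_⟩
  rw [intervalIntegral.integral_sub h1 h3, h2, h4, sub_sub_sub_comm]

theorem clm {F : Type*} [NormedAddCommGroup F] [NormedSpace ℝ F] [CompleteSpace E]
    [CompleteSpace F] (L : E →L[ℝ] F)
    (h : IsPrimitiveOn f f' s) : IsPrimitiveOn (fun x => L (f x)) (fun x => L (f' x)) s :=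
  fun x hx y hy => by
    obtain ⟨h1, h2⟩ := h x hx y hy
    refine ⟨?_, by rw [L.intervalIntegral_comp_comm h1, h2, map_sub]⟩
    rw [intervalIntegrable_iff] at h1 ⊢
    exact L.integrable_comp h1

theorem congr_ae (h : IsPrimitiveOn f f' s)
    (hg : ∀ x ∈ s, ∀ y ∈ s, ∀ᵐ t, t ∈ uIcc x y → f' t = g' t) : IsPrimitiveOn f g' s :=
  fun x hx y hy => by
    obtain ⟨h1, h2⟩ := h x hx y hy
    have h3 : ∀ᵐ t, t ∈ uIoc x y → f' t = g' t := by
      filter_upwards [hg x hx y hy] with t ht ht' using ht (uIoc_subset_uIcc ht')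
    refine ⟨h1.congr_ae ((ae_restrict_iff' measurableSet_uIoc).2 h3), ?_⟩
    rw [← h2]
    exact (intervalIntegral.integral_congr_ae h3).symm

theorem congr (h : IsPrimitiveOn f f' s) (hs : s.OrdConnected) (hf : EqOn f g s)
    (hg : EqOn f' g' s) : IsPrimitiveOn g g' s := by
  have h2 := h.congr_ae (g' := g') fun x hx y hy => .of_forall fun t ht =>
    hg (hs.uIcc_subset hx hy ht)
  intro x hx y hy
  rw [← hf hx, ← hf hy]
  exact h2 x hx y hy

theorem ae_hasDerivAt [CompleteSpace E] (h : IsPrimitiveOn f f' s) (hs : s.OrdConnected) {x y : ℝ}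
    (hx : x ∈ s) (hy : y ∈ s) : ∀ᵐ t, t ∈ uIcc x y → HasDerivAt f (f' t) t := by
  wlog hxy : x ≤ y generalizing x y
  · rw [uIcc_comm]; exact this hy hx (le_of_not_ge hxy)
  have h1 : ∀ᵐ t : ℝ, t ≠ x := by simp [ae_iff, measure_singleton]
  have h2 : ∀ᵐ t : ℝ, t ≠ y := by simp [ae_iff, measure_singleton]
  filter_upwards [(h x hx y hy).1.ae_hasDerivAt_integral, h1, h2] with t ht htx hty ht'
  have := (ht ht' x left_mem_uIcc).const_add (f x)
  refine this.congr_of_eventuallyEq ?_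
  rw [uIcc_of_le hxy] at ht'
  filter_upwards [Ioo_mem_nhds (lt_of_le_of_ne ht'.1 htx.symm) (lt_of_le_of_ne ht'.2 hty)]
    with τ hτ
  rw [(h x hx τ (hs.out hx hy ⟨hτ.1.le, hτ.2.le⟩)).2]
  abel

end General

variable {𝕜 : Type*} [RCLike 𝕜] {f g f' g' : ℝ → 𝕜} {s : Set ℝ}

theorem of_ac (h : ∀ x ∈ s, ∀ y ∈ s, AbsolutelyContinuousOnInterval f x y) :
    IsPrimitiveOn f (deriv f) s := fun x hx y hy =>
  ⟨(h x hx y hy).intervalIntegrable_deriv', (h x hx y hy).integral_deriv_eq_sub'⟩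

theorem of_ac_of_hasDerivAt
    (h : ∀ x ∈ s, ∀ y ∈ s, AbsolutelyContinuousOnInterval f x y)
    (h' : ∀ x ∈ s, ∀ y ∈ s, ∀ᵐ t, t ∈ uIcc x y → HasDerivAt f (f' t) t) :
    IsPrimitiveOn f f' s :=
  (of_ac h).congr_ae fun x hx y hy => by
    filter_upwards [h' x hx y hy] with t ht ht' using (ht ht').deriv

theorem mul (hs : s.OrdConnected) (hf : IsPrimitiveOn f f' s) (hg : IsPrimitiveOn g g' s) :
    IsPrimitiveOn (fun x => f x * g x) (fun x => f' x * g x + f x * g' x) s :=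
  of_ac_of_hasDerivAt (fun _ hx _ hy => (hf.ac hs hx hy).smul (hg.ac hs hx hy))
    fun x hx y hy => by
      filter_upwards [hf.ae_hasDerivAt hs hx hy, hg.ae_hasDerivAt hs hx hy] with t h1 h2 ht
      exact (h1 ht).mul (h2 ht)

theorem const_mul (c : 𝕜) (hf : IsPrimitiveOn f f' s) :
    IsPrimitiveOn (fun x => c * f x) (fun x => c * f' x) s := fun x hx y hy =>
  ⟨(hf x hx y hy).1.const_mul c, by
    rw [intervalIntegral.integral_const_mul, (hf x hx y hy).2, mul_sub]⟩

theorem inv (hs : s.OrdConnected) (hf : IsPrimitiveOn f f' s) (h0 : ∀ x ∈ s, f x ≠ 0) :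
    IsPrimitiveOn (fun x => (f x)⁻¹) (fun x => -f' x / f x ^ 2) s := by
  refine of_ac_of_hasDerivAt (fun x hx y hy => ?_) fun x hx y hy => ?_
  · have hc := hf.continuousOn_uIcc hs hx hy
    have h0' : ∀ t ∈ uIcc x y, f t ≠ 0 := fun t ht => h0 t (hs.uIcc_subset hx hy ht)
    obtain ⟨C, hC⟩ := isCompact_uIcc.exists_bound_of_continuousOn (hc.inv₀ h0')
    refine (hf.ac hs hx hy).of_dist_le (C := C * C) fun a ha b hb => ?_
    have hCa := hC a ha
    have hCb := hC b hb
    rw [dist_eq_norm, dist_eq_norm, inv_sub_inv (h0' a ha) (h0' b hb), norm_div, norm_mul,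
      norm_sub_rev, div_eq_mul_inv, mul_inv, ← norm_inv, ← norm_inv, mul_comm]
    have : 0 ≤ C := (norm_nonneg _).trans hCa
    gcongr
    exacts [hCa, hCb]
  · filter_upwards [hf.ae_hasDerivAt hs hx hy] with t ht ht'
    exact (ht ht').fun_inv (h0 t (hs.uIcc_subset hx hy ht'))

theorem pow_succ (hs : s.OrdConnected) (hf : IsPrimitiveOn f f' s) (n : ℕ) :
    IsPrimitiveOn (fun x => f x ^ (n + 1)) (fun x => (n + 1) * (f x ^ n * f' x)) s := by
  induction n with
  | zero => simpa using hf
  | succ n ih =>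
    refine (ih.mul hs hf).congr hs (fun x _ => by ring) (fun x _ => ?_)
    push_cast; ring

end IsPrimitiveOn

/-! ### Solutions as pairs `(u, p u')` and their Wronskians -/

theorem ae_mem_of_forall_uIcc {s : Set ℝ} (hs : IsOpen s) {P : ℝ → Prop}
    (h : ∀ x ∈ s, ∀ y ∈ s, ∀ᵐ t, t ∈ uIcc x y → P t) : ∀ᵐ t, t ∈ s → P t := by
  have h' : ∀ᵐ t, ∀ x y : ℚ, (x : ℝ) ∈ s → (y : ℝ) ∈ s → t ∈ uIcc (x : ℝ) y → P t := by
    simp only [ae_all_iff]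
    intro x y hx hy
    exact h x hx y hy
  filter_upwards [h'] with t ht hts
  obtain ⟨ε, hε, hball⟩ := Metric.isOpen_iff.1 hs t hts
  obtain ⟨x, hx1, hx2⟩ := exists_rat_btwn (show t - ε < t by linarith)
  obtain ⟨y, hy1, hy2⟩ := exists_rat_btwn (show t < t + ε by linarith)
  refine ht x y (hball ?_) (hball ?_) (mem_uIcc_of_le hx2.le hy1.le) <;>
    rw [Metric.mem_ball, Real.dist_eq, abs_lt] <;> constructor <;> linarith

namespace SturmLiouville

variable (S : SturmLiouville)

theorem isOpen_I : IsOpen S.I := isOpen_Ioo.preimage continuous_coe_real_ereal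

theorem ordConnected_I : S.I.OrdConnected :=
  ⟨fun _ hx _ hy _ hz => ⟨hx.1.trans_le (EReal.coe_le_coe_iff.2 hz.1),
    (EReal.coe_le_coe_iff.2 hz.2).trans_lt hy.2⟩⟩

theorem nonempty_I : S.I.Nonempty := by
  obtain ⟨x, h1, h2⟩ := EReal.lt_iff_exists_real_btwn.1 S.a_lt_b
  exact ⟨x, h1, h2⟩

theorem ae_p_pos : ∀ᵐ x, x ∈ S.I → 0 < S.p x :=
  (ae_restrict_iff' S.isOpen_I.measurableSet).1 S.p_pos

theorem ae_r_pos : ∀ᵐ x, x ∈ S.I → 0 < S.r x :=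
  (ae_restrict_iff' S.isOpen_I.measurableSet).1 S.r_pos

variable {S}

theorem uIcc_subset_I {x y : ℝ} (hx : x ∈ S.I) (hy : y ∈ S.I) : uIcc x y ⊆ S.I :=
  S.ordConnected_I.uIcc_subset hx hy

theorem intervalIntegrable_of_locallyIntegrableOn {E : Type*} [NormedAddCommGroup E] {f : ℝ → E}
    (hf : LocallyIntegrableOn f S.I) {x y : ℝ} (hx : x ∈ S.I) (hy : y ∈ S.I) :
    IntervalIntegrable f volume x y := by
  rw [intervalIntegrable_iff']
  exact hf.integrableOn_compact_subset (uIcc_subset_I hx hy) isCompact_uIcc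

theorem intervalIntegrable_p_inv {x y : ℝ} (hx : x ∈ S.I) (hy : y ∈ S.I) :
    IntervalIntegrable (fun x => (S.p x)⁻¹) volume x y := by
  simpa only [one_div] using intervalIntegrable_of_locallyIntegrableOn S.locInt_p hx hy

theorem intervalIntegrable_q {x y : ℝ} (hx : x ∈ S.I) (hy : y ∈ S.I) :
    IntervalIntegrable S.q volume x y :=
  intervalIntegrable_of_locallyIntegrableOn S.locInt_q hx hy

theorem intervalIntegrable_r {x y : ℝ} (hx : x ∈ S.I) (hy : y ∈ S.I) :
    IntervalIntegrable S.r volume x y :=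
  intervalIntegrable_of_locallyIntegrableOn S.locInt_r hx hy

/-- The pair `(u, u₁)` solves the first order system `u' = p⁻¹ u₁`, `u₁' = (q - z r) u` on `(a, b)`,
that is, `u` solves `ℓ u = z u` and `u₁ = p u'`. -/
structure IsSol {𝕜 : Type*} [RCLike 𝕜] (S : SturmLiouville) (z : 𝕜) (u u₁ : ℝ → 𝕜) : Prop where
  prim : IsPrimitiveOn u (fun x => ((S.p x)⁻¹ : ℝ) * u₁ x) S.I
  prim₁ : IsPrimitiveOn u₁ (fun x => ((S.q x : 𝕜) - z * S.r x) * u x) S.I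

theorem isSolution_iff {𝕜 : Type*} [RCLike 𝕜] {z : 𝕜} {u : ℝ → 𝕜} :
    S.IsSolution z u ↔ ∃ u₁, S.IsSol z u u₁ := by
  constructor
  · rintro ⟨hu, u₁, hu₁, h1, h2⟩
    rw [ae_restrict_iff' S.isOpen_I.measurableSet] at h1 h2
    refine ⟨u₁, (IsPrimitiveOn.of_ac hu).congr_ae fun x hx y hy => ?_,
      (IsPrimitiveOn.of_ac hu₁).congr_ae fun x hx y hy => ?_⟩
    · filter_upwards [h1, S.ae_p_pos] with t h hp ht
      have ht := uIcc_subset_I hx hy ht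
      have hp' : (S.p t : 𝕜) ≠ 0 := RCLike.ofReal_ne_zero.2 (hp ht).ne'
      rw [h ht, RCLike.real_smul_eq_coe_mul, RCLike.ofReal_inv, inv_mul_cancel_left₀ hp']
    · filter_upwards [h2, S.ae_r_pos] with t h hr ht
      have ht := uIcc_subset_I hx hy ht
      have hr' : (S.r t : 𝕜) ≠ 0 := RCLike.ofReal_ne_zero.2 (hr ht).ne'
      have h := h ht
      rw [RCLike.real_smul_eq_coe_mul, RCLike.real_smul_eq_coe_mul, RCLike.ofReal_inv,
        inv_mul_eq_iff_eq_mul₀ hr'] at h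
      linear_combination -h
  · rintro ⟨u₁, hu, hu₁⟩
    refine ⟨fun x hx y hy => hu.ac S.ordConnected_I hx hy, u₁,
      fun x hx y hy => hu₁.ac S.ordConnected_I hx hy, ?_, ?_⟩
    · rw [ae_restrict_iff' S.isOpen_I.measurableSet]
      filter_upwards [ae_mem_of_forall_uIcc S.isOpen_I fun x hx y hy =>
        hu.ae_hasDerivAt S.ordConnected_I hx hy, S.ae_p_pos] with t h hp ht
      have hp' : (S.p t : 𝕜) ≠ 0 := RCLike.ofReal_ne_zero.2 (hp ht).ne'
      rw [(h ht).deriv, RCLike.real_smul_eq_coe_mul, RCLike.ofReal_inv, mul_inv_cancel_left₀ hp']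
    · rw [ae_restrict_iff' S.isOpen_I.measurableSet]
      filter_upwards [ae_mem_of_forall_uIcc S.isOpen_I fun x hx y hy =>
        hu₁.ae_hasDerivAt S.ordConnected_I hx hy, S.ae_r_pos] with t h hr ht
      have hr' : (S.r t : 𝕜) ≠ 0 := RCLike.ofReal_ne_zero.2 (hr ht).ne'
      rw [(h ht).deriv, RCLike.real_smul_eq_coe_mul, RCLike.real_smul_eq_coe_mul,
        RCLike.ofReal_inv, inv_mul_eq_iff_eq_mul₀ hr']
      ring

/-- The modified Wronskian `f (p g') - (p f') g` of the pairs `(f, p f')` and `(g, p g')`. -/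
def wronskian {𝕜 : Type*} [RCLike 𝕜] (f f₁ g g₁ : ℝ → 𝕜) (x : ℝ) : 𝕜 := f x * g₁ x - f₁ x * g x

namespace IsSol

section

variable {𝕜 : Type*} [RCLike 𝕜] {z z' : 𝕜} {f f₁ g g₁ h h₁ : ℝ → 𝕜}

theorem isSolution (hf : S.IsSol z f f₁) : S.IsSolution z f := isSolution_iff.2 ⟨f₁, hf⟩

theorem sub (hf : S.IsSol z f f₁) (hg : S.IsSol z g g₁) :
    S.IsSol z (fun x => f x - g x) (fun x => f₁ x - g₁ x) :=
  ⟨(hf.prim.sub hg.prim).congr S.ordConnected_I (fun _ _ => rfl) fun x _ => by ring,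
    (hf.prim₁.sub hg.prim₁).congr S.ordConnected_I (fun _ _ => rfl) fun x _ => by ring⟩

theorem const_mul (c : 𝕜) (hf : S.IsSol z f f₁) :
    S.IsSol z (fun x => c * f x) (fun x => c * f₁ x) :=
  ⟨(hf.prim.const_mul c).congr S.ordConnected_I (fun _ _ => rfl) fun x _ => by ring,
    (hf.prim₁.const_mul c).congr S.ordConnected_I (fun _ _ => rfl) fun x _ => by ring⟩

/-- The Lagrange identity. -/
theorem wronskian_prim (hf : S.IsSol z f f₁) (hg : S.IsSol z' g g₁) :
    IsPrimitiveOn (wronskian f f₁ g g₁) (fun x => (z - z') * (S.r x * (f x * g x))) S.I :=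
  ((hf.prim.mul S.ordConnected_I hg.prim₁).sub (hf.prim₁.mul S.ordConnected_I hg.prim)).congr
    S.ordConnected_I (fun _ _ => rfl) fun x _ => by ring

theorem wronskian_const (hf : S.IsSol z f f₁) (hg : S.IsSol z g g₁) {x y : ℝ} (hx : x ∈ S.I)
    (hy : y ∈ S.I) : wronskian f f₁ g g₁ x = wronskian f f₁ g g₁ y := by
  have := (hf.wronskian_prim hg x hx y hy).2
  simp only [sub_self, zero_mul, intervalIntegral.integral_zero] at this
  exact (sub_eq_zero.1 this.symm).symm

/-- Two solutions `f`, `g` with nonvanishing Wronskian span all solutions. -/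
theorem wronskian_mul_eq (hf : S.IsSol z f f₁) (hg : S.IsSol z g g₁) (hh : S.IsSol z h h₁)
    {x y : ℝ} (hx : x ∈ S.I) (hy : y ∈ S.I) :
    wronskian f f₁ g g₁ y * h x =
      wronskian h h₁ g g₁ y * f x - wronskian h h₁ f f₁ y * g x ∧
    wronskian f f₁ g g₁ y * h₁ x =
      wronskian h h₁ g g₁ y * f₁ x - wronskian h h₁ f f₁ y * g₁ x := by
  rw [hf.wronskian_const hg hy hx, hh.wronskian_const hg hy hx, hh.wronskian_const hf hy hx]
  unfold wronskian
  constructor <;> ring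

end

theorem ofReal {t : ℝ} {u u₁ : ℝ → ℝ} (h : S.IsSol t u u₁) :
    S.IsSol (t : ℂ) (fun x => (u x : ℂ)) (fun x => (u₁ x : ℂ)) :=
  ⟨(h.prim.clm Complex.ofRealCLM).congr S.ordConnected_I (fun _ _ => rfl) fun x _ => by simp,
    (h.prim₁.clm Complex.ofRealCLM).congr S.ordConnected_I (fun _ _ => rfl) fun x _ => by simp⟩

theorem re {t : ℝ} {u u₁ : ℝ → ℂ} (h : S.IsSol (t : ℂ) u u₁) :
    S.IsSol t (fun x => (u x).re) (fun x => (u₁ x).re) :=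
  ⟨(h.prim.clm Complex.reCLM).congr S.ordConnected_I (fun _ _ => rfl) fun x _ => by simp,
    (h.prim₁.clm Complex.reCLM).congr S.ordConnected_I (fun _ _ => rfl) fun x _ => by
      simp⟩

end IsSol
end SturmLiouville

/-! ### Linear systems with locally integrable coefficients -/

namespace IsPrimitiveOn

variable {E : Type*} [NormedAddCommGroup E] [NormedSpace ℝ E] {f g : ℝ → E} {s : Set ℝ} {c : ℝ}

theorem of_base
    (h : ∀ x ∈ s, IntervalIntegrable g volume c x ∧ ∫ t in c..x, g t = f x - f c) :
    IsPrimitiveOn f g s := fun x hx y hy => by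
  obtain ⟨h1, h2⟩ := h x hx
  obtain ⟨h3, h4⟩ := h y hy
  refine ⟨h1.symm.trans h3, ?_⟩
  rw [← intervalIntegral.integral_interval_sub_left h3 h1, h2, h4, sub_sub_sub_cancel_right]

theorem integral (hg : ∀ x ∈ s, IntervalIntegrable g volume c x) :
    IsPrimitiveOn (fun x => ∫ t in c..x, g t) g s :=
  of_base fun x hx => ⟨hg x hx, by simp⟩

end IsPrimitiveOn

namespace LinearSystem

variable {E : Type*} [NormedAddCommGroup E] [NormedSpace ℂ E] {B : ℝ → E →L[ℂ] E} {s : Set ℝ}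
  {c : ℝ}

theorem intervalIntegrable_apply {x y : ℝ} {f : ℝ → E} (hB : IntervalIntegrable B volume x y)
    (hf : ContinuousOn f (uIcc x y)) : IntervalIntegrable (fun t => B t (f t)) volume x y := by
  obtain ⟨C, hC⟩ := isCompact_uIcc.exists_bound_of_continuousOn hf
  rw [intervalIntegrable_iff] at hB ⊢
  have hfm : AEStronglyMeasurable f (volume.restrict (uIoc x y)) :=
    (hf.mono uIoc_subset_uIcc).aestronglyMeasurable measurableSet_uIoc
  refine (hB.norm.mul_const C).mono'
    ((ContinuousLinearMap.id ℂ (E →L[ℂ] E)).aestronglyMeasurable_comp₂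
      hB.aestronglyMeasurable hfm) ?_
  rw [ae_restrict_iff' measurableSet_uIoc]
  refine .of_forall fun t ht => (B t).le_opNorm_of_le (hC t (uIoc_subset_uIcc ht))

/-- The coefficients of the expansion in powers of `ζ` of the solution of `Y' = ζ B Y`, `Y(c) = e`,
obtained by Picard iteration. -/
noncomputable def coeff (B : ℝ → E →L[ℂ] E) (c : ℝ) (e : E) : ℕ → ℝ → E
  | 0 => fun _ => e
  | n + 1 => fun x => ∫ t in c..x, B t (coeff B c e n t)

variable (hs : s.OrdConnected) (hc : c ∈ s)
  (hB : ∀ x ∈ s, ∀ y ∈ s, IntervalIntegrable B volume x y)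

include hs hc hB

theorem coeff_prim (e : E) (n : ℕ) :
    IsPrimitiveOn (coeff B c e (n + 1)) (fun t => B t (coeff B c e n t)) s := by
  induction n with
  | zero => exact .integral fun x hx => intervalIntegrable_apply (hB c hc x hx) continuousOn_const
  | succ n ih =>
    exact .integral fun x hx =>
      intervalIntegrable_apply (hB c hc x hx) (ih.continuousOn_uIcc hs hc hx)

theorem continuousOn_coeff (e : E) (n : ℕ) {x : ℝ} (hx : x ∈ s) :
    ContinuousOn (coeff B c e n) (uIcc c x) := by
  cases n with
  | zero => exact continuousOn_const
  | succ n => exact (coeff_prim hs hc hB e n).continuousOn_uIcc hs hc hx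

theorem norm_coeff_le (e : E) (n : ℕ) {x : ℝ} (hx : x ∈ s) :
    ‖coeff B c e n x‖ ≤ ‖e‖ * (|∫ t in c..x, ‖B t‖| ^ n / n.factorial) := by
  have hK : IsPrimitiveOn (fun x => ∫ t in c..x, ‖B t‖) (fun t => ‖B t‖) s :=
    .integral fun x hx => (hB c hc x hx).norm
  set K : ℝ → ℝ := fun x => ∫ t in c..x, ‖B t‖ with hKdef
  induction n generalizing x with
  | zero => simp [coeff]
  | succ n ih =>
    -- `K` has a constant sign `σ` between `c` and `x`.
    obtain ⟨σ, hσ, hKσ⟩ : ∃ σ : ℝ, |σ| = 1 ∧ ∀ t ∈ uIcc c x, |K t| = σ * K t := by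
      rcases le_total c x with hcx | hcx
      · refine ⟨1, by simp, fun t ht => ?_⟩
        rw [uIcc_of_le hcx] at ht
        rw [one_mul, abs_of_nonneg (intervalIntegral.integral_nonneg ht.1 fun _ _ => norm_nonneg _)]
      · refine ⟨-1, by simp, fun t ht => ?_⟩
        rw [uIcc_of_ge hcx] at ht
        have : 0 ≤ ∫ τ in t..c, ‖B τ‖ :=
          intervalIntegral.integral_nonneg ht.2 fun _ _ => norm_nonneg _
        rw [abs_of_nonpos, neg_one_mul]
        simp only [hKdef]
        rw [intervalIntegral.integral_symm]; linarith
    have hpow := (hK.pow_succ hs n).const_mul (‖e‖ * σ ^ n / (n + 1).factorial) c hc x hx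
    have hfac : ((n + 1).factorial : ℝ) = (n + 1) * n.factorial := by
      push_cast [Nat.factorial_succ]; ring
    have hn0 : (n.factorial : ℝ) ≠ 0 := by positivity
    have hn1 : (n + 1 : ℝ) ≠ 0 := by positivity
    have hle := intervalIntegral.norm_integral_le_abs_of_norm_le (μ := volume) (a := c) (b := x)
      (f := fun t => B t (coeff B c e n t)) ?_ hpow.1
    · refine hle.trans ?_
      rw [hpow.2]
      have hKc : K c = 0 := by simp [hKdef]
      have h1 : |σ ^ n| = 1 := by rw [abs_pow, hσ, one_pow]
      dsimp only
      rw [hKc, zero_pow n.succ_ne_zero, mul_zero, sub_zero, abs_mul, abs_div, abs_mul, h1, abs_norm,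
        abs_pow, Nat.abs_cast]
      exact le_of_eq (by ring)
    · rw [ae_restrict_iff' measurableSet_uIoc]
      refine .of_forall fun t ht => ?_
      have ht := uIoc_subset_uIcc ht
      refine ((B t).le_opNorm_of_le (ih (hs.uIcc_subset hc hx ht))).trans (le_of_eq ?_)
      change ‖B t‖ * (‖e‖ * (|K t| ^ n / n.factorial)) = _
      rw [hKσ t ht, hfac, mul_pow]
      field_simp

/-- The initial value problem `Y' = ζ B Y`, `Y(c) = e` has a solution which is entire in `ζ`. -/
theorem exists_solution [CompleteSpace E] (e : E) :
    ∃ Y : ℂ → ℝ → E, (∀ ζ, Y ζ c = e) ∧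
      (∀ ζ, IsPrimitiveOn (Y ζ) (fun t => ζ • B t (Y ζ t)) s) ∧
      ∀ x ∈ s, Differentiable ℂ fun ζ => Y ζ x := by
  have hbound : ∀ x ∈ s, ∀ M R : ℝ, |∫ t in c..x, ‖B t‖| ≤ M → ∀ ζ : ℂ, ‖ζ‖ ≤ R → ∀ n,
      ‖ζ ^ n • coeff B c e n x‖ ≤ ‖e‖ * ((R * M) ^ n / n.factorial) := by
    intro x hx M R hM ζ hζ n
    rw [norm_smul, norm_pow]
    have hR : 0 ≤ R := (norm_nonneg _).trans hζ
    have := norm_coeff_le hs hc hB e n hx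
    calc ‖ζ‖ ^ n * ‖coeff B c e n x‖
        ≤ R ^ n * (‖e‖ * (M ^ n / n.factorial)) := by
          gcongr
          refine this.trans ?_
          gcongr
      _ = _ := by rw [mul_pow]; ring
  have hsum : ∀ A : ℝ, Summable fun n : ℕ => ‖e‖ * (A ^ n / n.factorial) := fun A =>
    (Real.summable_pow_div_factorial A).mul_left _
  have hsummable : ∀ x ∈ s, ∀ ζ : ℂ, Summable fun n => ζ ^ n • coeff B c e n x := fun x hx ζ =>
    .of_norm_bounded (hsum _) (hbound x hx _ _ le_rfl ζ le_rfl)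
  refine ⟨fun ζ x => ∑' n, ζ ^ n • coeff B c e n x, fun ζ => ?_, fun ζ => ?_, fun x hx ζ => ?_⟩
  · dsimp only
    rw [tsum_eq_single 0]
    · simp [coeff]
    · rintro (_ | n) hn
      · exact absurd rfl hn
      · simp [coeff]
  · refine .of_base (c := c) fun x hx => ?_
    have hKc : ContinuousOn (fun x => ∫ t in c..x, ‖B t‖) (uIcc c x) :=
      (IsPrimitiveOn.integral fun x hx => (hB c hc x hx).norm).continuousOn_uIcc hs hc hx
    obtain ⟨M, hM⟩ := isCompact_uIcc.exists_bound_of_continuousOn hKc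
    have hb : ∀ t ∈ uIcc c x, ∀ n, ‖ζ ^ n • coeff B c e n t‖ ≤
        ‖e‖ * ((‖ζ‖ * M) ^ n / n.factorial) := fun t ht =>
      hbound t (hs.uIcc_subset hc hx ht) M _ (hM t ht) ζ le_rfl
    have hcont : ContinuousOn (fun t => ∑' n, ζ ^ n • coeff B c e n t) (uIcc c x) :=
      continuousOn_tsum (fun n => (continuousOn_coeff hs hc hB e n hx).const_smul _) (hsum _)
        fun n t ht => hb t ht n
    refine ⟨(intervalIntegrable_apply (hB c hc x hx) hcont).smul ζ, ?_⟩
    have key := intervalIntegral.hasSum_integral_of_dominated_convergence (μ := volume) (a := c)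
      (b := x) (F := fun n t => ζ • B t (ζ ^ n • coeff B c e n t))
      (f := fun t => ζ • B t (∑' n, ζ ^ n • coeff B c e n t))
      (fun n t => ‖ζ‖ * (‖B t‖ * (‖e‖ * ((‖ζ‖ * M) ^ n / n.factorial)))) (fun n => ?_) (fun n => ?_)
      (.of_forall fun t _ => ((hsum _).mul_left _).mul_left _) ?_ ?_
    · have hL : ∀ n, ∫ t in c..x, ζ • B t (ζ ^ n • coeff B c e n t) =
          ζ ^ (n + 1) • coeff B c e (n + 1) x := fun n => by
        simp only [map_smul, smul_smul, ← _root_.pow_succ']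
        rw [intervalIntegral.integral_smul]
        rfl
      simp only [hL] at key
      dsimp only
      rw [← key.tsum_eq, (hsummable x hx ζ).tsum_eq_zero_add, (hsummable c hc ζ).tsum_eq_zero_add]
      simp [coeff]
    · have := intervalIntegrable_apply (hB c hc x hx)
        ((continuousOn_coeff hs hc hB e n hx).const_smul (ζ ^ n))
      exact (intervalIntegrable_iff.1 (this.smul ζ)).aestronglyMeasurable
    · refine .of_forall fun t ht => ?_
      rw [norm_smul]
      gcongr
      exact (B t).le_opNorm_of_le (hb t (uIoc_subset_uIcc ht) n)
    · have h1 : ∀ t, ∑' n : ℕ, ‖ζ‖ * (‖B t‖ * (‖e‖ * ((‖ζ‖ * M) ^ n / n.factorial))) =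
          ‖ζ‖ * (‖B t‖ * ∑' n : ℕ, ‖e‖ * ((‖ζ‖ * M) ^ n / n.factorial)) := fun t => by
        rw [tsum_mul_left, tsum_mul_left]
      simp only [h1]
      exact ((hB c hc x hx).norm.mul_const _).const_mul _
    · refine .of_forall fun t ht => ?_
      have h1 := (hsummable t (hs.uIcc_subset hc hx (uIoc_subset_uIcc ht)) ζ).hasSum
      exact ((B t).hasSum h1).const_smul ζ
  · have := Complex.differentiableOn_tsum_of_summable_norm (hsum ((‖ζ‖ + 1) * |∫ t in c..x, ‖B t‖|))
      (F := fun n (ζ : ℂ) => ζ ^ n • coeff B c e n x) (U := Metric.ball 0 (‖ζ‖ + 1))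
      (fun n => ((differentiable_id.pow n).smul_const _).differentiableOn) Metric.isOpen_ball
      fun n w hw => hbound x hx _ _ le_rfl w (by simpa using (mem_ball_zero_iff.1 hw).le) n
    exact this.differentiableAt (Metric.isOpen_ball.mem_nhds (by simp))

end LinearSystem

/-! ### Existence of solutions, entire in the spectral parameter -/

namespace SturmLiouville

variable {S : SturmLiouville} {c : ℝ}

theorem exists_isSol_zero (hc : c ∈ S.I) (α β : ℂ) :
    ∃ u u₁ : ℝ → ℂ, S.IsSol (0 : ℂ) u u₁ ∧ u c = α ∧ u₁ c = β := by
  let B₁ : (ℂ × ℂ) →L[ℂ] (ℂ × ℂ) := (ContinuousLinearMap.snd ℂ ℂ ℂ).prod 0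
  let B₂ : (ℂ × ℂ) →L[ℂ] (ℂ × ℂ) := (0 : (ℂ × ℂ) →L[ℂ] ℂ).prod (ContinuousLinearMap.fst ℂ ℂ ℂ)
  obtain ⟨Y, h0, hY, -⟩ := LinearSystem.exists_solution (s := S.I)
    (B := fun t => (S.p t)⁻¹ • B₁ + S.q t • B₂) S.ordConnected_I hc
    (fun x hx y hy => by
      have h1 := intervalIntegrable_p_inv hx hy
      have h2 := intervalIntegrable_q hx hy
      rw [intervalIntegrable_iff] at *
      exact (h1.smul_const B₁).add (h2.smul_const B₂)) (α, β)
  refine ⟨fun x => (Y 1 x).1, fun x => (Y 1 x).2, ⟨?_, ?_⟩, by simp [h0], by simp [h0]⟩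
  · refine ((hY 1).clm (ContinuousLinearMap.fst ℝ ℂ ℂ)).congr S.ordConnected_I (fun _ _ => rfl)
      fun x _ => ?_
    simp [B₁, B₂]
  · refine ((hY 1).clm (ContinuousLinearMap.snd ℝ ℂ ℂ)).congr S.ordConnected_I (fun _ _ => rfl)
      fun x _ => ?_
    simp [B₁, B₂]

/-- For fixed initial data at `c`, the solution of `ℓ u = z u` is entire in `z`. It is found by
variation of constants from two solutions of `ℓ u = 0`; the coefficients of the resulting system
are multiples of `z`. -/
theorem exists_isSol_entire (hc : c ∈ S.I) (α β : ℂ) :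
    ∃ u u₁ : ℂ → ℝ → ℂ, (∀ z, S.IsSol z (u z) (u₁ z) ∧ u z c = α ∧ u₁ z c = β) ∧
      ∀ x ∈ S.I, Differentiable ℂ fun z => u z x := by
  have hI := S.ordConnected_I
  obtain ⟨φ, φ₁, hφ, hφc, hφ₁c⟩ := exists_isSol_zero hc 1 0
  obtain ⟨s, s₁, hs, hsc, hs₁c⟩ := exists_isSol_zero hc 0 1
  have hW : ∀ x ∈ S.I, φ x * s₁ x - φ₁ x * s x = 1 := fun x hx => by
    have := hφ.wronskian_const hs hx hc
    simpa [wronskian, hφc, hφ₁c, hsc, hs₁c] using this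
  let π₁ := ContinuousLinearMap.fst ℂ ℂ ℂ
  let π₂ := ContinuousLinearMap.snd ℂ ℂ ℂ
  let M₁ : (ℂ × ℂ) →L[ℂ] (ℂ × ℂ) := π₁.prod (-π₂)
  let M₂ : (ℂ × ℂ) →L[ℂ] (ℂ × ℂ) := π₂.prod 0
  let M₃ : (ℂ × ℂ) →L[ℂ] (ℂ × ℂ) := (0 : (ℂ × ℂ) →L[ℂ] ℂ).prod (-π₁)
  obtain ⟨Z, h0, hZ, hd⟩ := LinearSystem.exists_solution (s := S.I)
    (B := fun t => ((S.r t : ℂ) * (φ t * s t)) • M₁ + ((S.r t : ℂ) * (s t * s t)) • M₂ +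
      ((S.r t : ℂ) * (φ t * φ t)) • M₃) hI hc
    (fun x hx y hy => by
      have hr : IntervalIntegrable (fun t => (S.r t : ℂ)) volume x y :=
        ⟨(intervalIntegrable_r hx hy).1.ofReal, (intervalIntegrable_r hx hy).2.ofReal⟩
      have c1 := hφ.prim.continuousOn_uIcc hI hx hy
      have c2 := hs.prim.continuousOn_uIcc hI hx hy
      have h1 := hr.mul_continuousOn (c1.mul c2)
      have h2 := hr.mul_continuousOn (c2.mul c2)
      have h3 := hr.mul_continuousOn (c1.mul c1)
      rw [intervalIntegrable_iff] at *
      exact ((h1.smul_const M₁).add (h2.smul_const M₂)).add (h3.smul_const M₃)) (α, β)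
  have hZ₁ : ∀ z, IsPrimitiveOn (fun x => (Z z x).1)
      (fun x => z * (S.r x * (s x * (φ x * (Z z x).1 + s x * (Z z x).2)))) S.I := fun z => by
    refine ((hZ z).clm (ContinuousLinearMap.fst ℝ ℂ ℂ)).congr hI (fun _ _ => rfl) fun x _ => ?_
    simp [M₁, M₂, M₃, π₁, π₂]
    exact Or.inl (by ring)
  have hZ₂ : ∀ z, IsPrimitiveOn (fun x => (Z z x).2)
      (fun x => -(z * (S.r x * (φ x * (φ x * (Z z x).1 + s x * (Z z x).2))))) S.I := fun z => by
    refine ((hZ z).clm (ContinuousLinearMap.snd ℝ ℂ ℂ)).congr hI (fun _ _ => rfl) fun x _ => ?_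
    simp [M₁, M₂, M₃, π₁, π₂]
    ring
  refine ⟨fun z x => φ x * (Z z x).1 + s x * (Z z x).2,
    fun z x => φ₁ x * (Z z x).1 + s₁ x * (Z z x).2, fun z => ⟨⟨?_, ?_⟩, ?_, ?_⟩, fun x hx => ?_⟩
  · refine ((hφ.prim.mul hI (hZ₁ z)).add (hs.prim.mul hI (hZ₂ z))).congr hI (fun _ _ => rfl)
      fun x hx => ?_
    ring
  · refine ((hφ.prim₁.mul hI (hZ₁ z)).add (hs.prim₁.mul hI (hZ₂ z))).congr hI (fun _ _ => rfl)
      fun x hx => ?_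
    simp only
    linear_combination (-(z * S.r x * (φ x * (Z z x).1 + s x * (Z z x).2))) * hW x hx
  · simp [h0, hφc, hsc]
  · simp [h0, hφ₁c, hs₁c]
  · have h1 : Differentiable ℂ fun z => (Z z x).1 := (hd x hx).fst
    have h2 : Differentiable ℂ fun z => (Z z x).2 := (hd x hx).snd
    exact (h1.const_mul _).add (h2.const_mul _)

/-- A basis `φ(z, ·)`, `s(z, ·)` of the solutions of `ℓ u = z u`, normalized at `c` and entire
in `z`. -/
structure FundamentalSystem (S : SturmLiouville) (c : ℝ) where
  φ : ℂ → ℝ → ℂ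
  φ₁ : ℂ → ℝ → ℂ
  s : ℂ → ℝ → ℂ
  s₁ : ℂ → ℝ → ℂ
  mem : c ∈ S.I
  φ_sol : ∀ z, S.IsSol z (φ z) (φ₁ z)
  s_sol : ∀ z, S.IsSol z (s z) (s₁ z)
  φ_c : ∀ z, φ z c = 1
  φ₁_c : ∀ z, φ₁ z c = 0
  s_c : ∀ z, s z c = 0
  s₁_c : ∀ z, s₁ z c = 1
  φ_entire : ∀ x ∈ S.I, Differentiable ℂ fun z => φ z x
  s_entire : ∀ x ∈ S.I, Differentiable ℂ fun z => s z x

theorem nonempty_fundamentalSystem (hc : c ∈ S.I) : Nonempty (S.FundamentalSystem c) := by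
  obtain ⟨φ, φ₁, hφ, hφd⟩ := exists_isSol_entire hc 1 0
  obtain ⟨s, s₁, hs, hsd⟩ := exists_isSol_entire hc 0 1
  exact ⟨⟨φ, φ₁, s, s₁, hc, fun z => (hφ z).1, fun z => (hs z).1, fun z => (hφ z).2.1,
    fun z => (hφ z).2.2, fun z => (hs z).2.1, fun z => (hs z).2.2, hφd, hsd⟩⟩

theorem FundamentalSystem.wronskian_eq_one (F : S.FundamentalSystem c) (z : ℂ) :
    wronskian (F.φ z) (F.φ₁ z) (F.s z) (F.s₁ z) c = 1 := by
  simp [wronskian, F.φ_c, F.φ₁_c, F.s_c, F.s₁_c]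

namespace IsSol

variable {z : ℂ} {f f₁ g g₁ : ℝ → ℂ} {x : ℝ}

theorem eq_zero_of_eq_zero (hf : S.IsSol z f f₁) (hx : x ∈ S.I) (h0 : f x = 0) (h1 : f₁ x = 0)
    {y : ℝ} (hy : y ∈ S.I) : f y = 0 ∧ f₁ y = 0 := by
  obtain ⟨F⟩ := nonempty_fundamentalSystem hx
  have := (F.φ_sol z).wronskian_mul_eq (F.s_sol z) hf hy hx
  rw [F.wronskian_eq_one] at this
  simpa [wronskian, h0, h1] using this

/-- Solutions with vanishing Wronskian are proportional. -/
theorem eq_const_mul_of_wronskian_eq_zero (hf : S.IsSol z f f₁) (hg : S.IsSol z g g₁)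
    (hx : x ∈ S.I) (hgx : g x ≠ 0) (hW : wronskian f f₁ g g₁ x = 0) :
    ∀ y ∈ S.I, f y = f x / g x * g y := by
  have hh := hf.sub (hg.const_mul (f x / g x))
  have h0 : f x - f x / g x * g x = 0 := by field_simp; ring
  have h1 : f₁ x - f x / g x * g₁ x = 0 := by
    unfold wronskian at hW
    field_simp
    linear_combination -hW
  intro y hy
  exact sub_eq_zero.1 (hh.eq_zero_of_eq_zero hx h0 h1 hy).1

end IsSol
end SturmLiouville

/-! ### Integrability near the right endpoint -/

namespace SturmLiouville

variable {S : SturmLiouville} {c c' : ℝ}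

theorem near_right_subset_I (hc : c ∈ S.I) : S.near .right c ⊆ S.I := fun _ hx =>
  ⟨hc.1.trans_le (EReal.coe_le_coe_iff.2 hx.1), hx.2⟩

theorem self_mem_near_right (hc : c ∈ S.I) : c ∈ S.near .right c := ⟨le_rfl, hc.2⟩

theorem Icc_subset_near_right {x y : ℝ} (hx : x ∈ S.near .right c) (hy : y ∈ S.near .right c) :
    Icc x y ⊆ S.near .right c := fun _ ht =>
  ⟨hx.1.trans ht.1, (EReal.coe_le_coe_iff.2 ht.2).trans_lt hy.2⟩

theorem ordConnected_near_right : (S.near .right c).OrdConnected :=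
  ⟨fun _ hx _ hy => Icc_subset_near_right hx hy⟩

theorem near_right_antitone (h : c ≤ c') : S.near .right c' ⊆ S.near .right c := fun _ hx =>
  ⟨h.trans hx.1, hx.2⟩

theorem measurableSet_near_right : MeasurableSet (S.near .right c) :=
  ordConnected_near_right.measurableSet

/-- The right endpoint is the limit of a sequence of points of the interval. -/
theorem exists_seq_near_right (hc : c ∈ S.I) : ∃ y : ℕ → ℝ, Monotone y ∧
    (∀ n, y n ∈ S.near .right c) ∧ ∀ x ∈ S.near .right c, ∃ n, x < y n := by
  obtain ⟨v, hv, hv', hvlim⟩ := exists_seq_strictMono_tendsto' (show (c : EReal) < S.b from hc.2)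
  have hcoe : ∀ n, ((v n).toReal : EReal) = v n := fun n =>
    EReal.coe_toReal (ne_top_of_lt (hv' n).2) (ne_bot_of_gt (hv' n).1)
  refine ⟨fun n => (v n).toReal, fun m n hmn => ?_, fun n => ?_, fun x hx => ?_⟩
  · rw [← EReal.coe_le_coe_iff, hcoe, hcoe]
    exact hv.monotone hmn
  · refine ⟨?_, ?_⟩
    · rw [← EReal.coe_le_coe_iff, hcoe]; exact (hv' n).1.le
    · rw [hcoe]; exact (hv' n).2
  · obtain ⟨n, hn⟩ := (hvlim.eventually (lt_mem_nhds hx.2)).exists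
    refine ⟨n, ?_⟩
    rw [← EReal.coe_lt_coe_iff, hcoe]; exact hn

theorem near_right_eq_iUnion {y : ℕ → ℝ} (hy : ∀ n, y n ∈ S.near .right c)
    (hy' : ∀ x ∈ S.near .right c, ∃ n, x < y n) (hc : c ∈ S.I) :
    S.near .right c = ⋃ n, Icc c (y n) := by
  refine subset_antisymm (fun x hx => ?_) (iUnion_subset fun n =>
    Icc_subset_near_right (self_mem_near_right hc) (hy n))
  obtain ⟨n, hn⟩ := hy' x hx
  exact mem_iUnion.2 ⟨n, hx.1, hn.le⟩

theorem lintegral_near_right_le (hc : c ∈ S.I) {g : ℝ → ℝ} {K : ℝ}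
    (hg : ∀ y ∈ S.near .right c, IntervalIntegrable g volume c y)
    (h0 : ∀ᵐ t, t ∈ S.I → 0 ≤ g t) (hK : ∀ y ∈ S.near .right c, ∫ t in c..y, g t ≤ K) :
    ∫⁻ t in S.near .right c, ENNReal.ofReal (g t) ≤ ENNReal.ofReal K := by
  obtain ⟨y, hmono, hy, hy'⟩ := exists_seq_near_right hc
  have hU := near_right_eq_iUnion hy hy' hc
  have hdir : Directed (· ⊆ ·) fun n => Icc c (y n) :=
    (monotone_nat_of_le_succ fun n => Icc_subset_Icc_right (hmono n.le_succ)).directed_le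
  rw [hU, setLIntegral_iUnion_of_directed _ hdir]
  refine iSup_le fun n => ?_
  have hi : IntegrableOn g (Icc c (y n)) :=
    (intervalIntegrable_iff_integrableOn_Icc_of_le (hy n).1).1 (hg _ (hy n))
  rw [← ofReal_integral_eq_lintegral_ofReal hi, integral_Icc_eq_integral_Ioc,
    ← intervalIntegral.integral_of_le (hy n).1]
  · exact ENNReal.ofReal_le_ofReal (hK _ (hy n))
  · refine (ae_restrict_iff' measurableSet_Icc).2 ?_
    filter_upwards [h0] with t ht ht'
    exact ht (near_right_subset_I hc
      (Icc_subset_near_right (self_mem_near_right hc) (hy n) ht'))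

theorem integrableOn_near_right_of_bound (hc : c ∈ S.I) {g : ℝ → ℝ} {K : ℝ}
    (hg : ∀ y ∈ S.near .right c, IntervalIntegrable g volume c y)
    (h0 : ∀ᵐ t, t ∈ S.I → 0 ≤ g t) (hK : ∀ y ∈ S.near .right c, ∫ t in c..y, g t ≤ K) :
    IntegrableOn g (S.near .right c) := by
  obtain ⟨y, hmono, hy, hy'⟩ := exists_seq_near_right hc
  have hU := near_right_eq_iUnion hy hy' hc
  refine ⟨?_, ?_⟩
  · rw [hU, aestronglyMeasurable_iUnion_iff]
    exact fun n => ((intervalIntegrable_iff_integrableOn_Icc_of_le (hy n).1).1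
      (hg _ (hy n))).aestronglyMeasurable
  · rw [hasFiniteIntegral_iff_ofReal]
    · exact (lintegral_near_right_le hc hg h0 hK).trans_lt ENNReal.ofReal_lt_top
    · refine (ae_restrict_iff' measurableSet_near_right).2 ?_
      filter_upwards [h0] with t ht ht' using ht (near_right_subset_I hc ht')

theorem intervalIntegrable_of_near_right {g : ℝ → ℝ} (hg : IntegrableOn g (S.near .right c))
    {x y : ℝ} (hx : x ∈ S.near .right c) (hy : y ∈ S.near .right c) :
    IntervalIntegrable g volume x y := by
  rw [intervalIntegrable_iff']
  exact hg.mono_set (ordConnected_near_right.uIcc_subset hx hy)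

theorem intervalIntegral_le_of_near_right (hc : c ∈ S.I) {g : ℝ → ℝ}
    (hg : IntegrableOn g (S.near .right c)) (h0 : ∀ᵐ t, t ∈ S.I → 0 ≤ g t) {y : ℝ}
    (hy : y ∈ S.near .right c) : ∫ t in c..y, g t ≤ ∫ t in S.near .right c, g t := by
  rw [intervalIntegral.integral_of_le hy.1]
  refine setIntegral_mono_set hg ?_ (Ioc_subset_Icc_self.trans
    (Icc_subset_near_right (self_mem_near_right hc) hy)).eventuallyLE
  refine (ae_restrict_iff' measurableSet_near_right).2 ?_
  filter_upwards [h0] with t ht ht' using ht (near_right_subset_I hc ht')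

/-- The tails of a convergent integral are small. -/
theorem exists_tail_le (hc : c ∈ S.I) {g : ℝ → ℝ} (hg : IntegrableOn g (S.near .right c))
    (h0 : ∀ᵐ t, t ∈ S.I → 0 ≤ g t) {ε : ℝ} (hε : 0 < ε) :
    ∃ d ∈ S.near .right c, ∀ y ∈ S.near .right d, ∫ t in d..y, g t ≤ ε := by
  set A := (fun y => ∫ t in c..y, g t) '' S.near .right c
  have hA : A.Nonempty := ⟨_, c, self_mem_near_right hc, rfl⟩
  have hbdd : BddAbove A := ⟨∫ t in S.near .right c, g t, by
    rintro _ ⟨y, hy, rfl⟩; exact intervalIntegral_le_of_near_right hc hg h0 hy⟩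
  obtain ⟨_, ⟨d, hd, rfl⟩, hlt⟩ := exists_lt_of_lt_csSup hA (show sSup A - ε < sSup A by linarith)
  refine ⟨d, hd, fun y hy => ?_⟩
  have hy' := near_right_antitone hd.1 hy
  have hcm := self_mem_near_right hc
  have h1 : ∫ t in c..y, g t ≤ sSup A := le_csSup hbdd ⟨y, hy', rfl⟩
  rw [← intervalIntegral.integral_interval_sub_left (intervalIntegrable_of_near_right hg hcm hy')
    (intervalIntegrable_of_near_right hg hcm hd)]
  simp only at hlt
  linarith

/-! ### Square integrable solutions and the limit point case -/

theorem L2Near.integrableOn {u : ℝ → ℂ} (h : S.L2Near .right u) (hu : ContinuousOn u S.I)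
    (hc : c ∈ S.I) : IntegrableOn (fun x => ‖u x‖ ^ 2 * S.r x) (S.near .right c) := by
  obtain ⟨d, hd, hint⟩ := h
  have h1 : IntegrableOn (fun x => ‖u x‖ ^ 2 * S.r x) (uIcc c d) := by
    rw [← intervalIntegrable_iff']
    exact (intervalIntegrable_r hc hd).continuousOn_mul
      ((hu.mono (uIcc_subset_I hc hd)).norm.pow 2)
  refine (h1.union hint).mono_set fun x hx => ?_
  rcases le_total x d with hxd | hxd
  · exact .inl (mem_uIcc_of_le hx.1 hxd)
  · exact .inr ⟨hxd, hx.2⟩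

theorem l2Near_of_le {u : ℝ → ℂ} (hu : ContinuousOn u S.I) (hc : c ∈ S.I) {g : ℝ → ℝ}
    (hg : IntegrableOn (fun x => g x * S.r x) (S.near .right c))
    (h : ∀ x ∈ S.near .right c, ‖u x‖ ^ 2 ≤ g x) : S.L2Near .right u := by
  refine ⟨c, hc, hg.mono' ?_ ?_⟩
  · have hr : AEStronglyMeasurable S.r (volume.restrict (S.near .right c)) :=
      (S.aemeasurable_r.mono_measure
        (Measure.restrict_mono (near_right_subset_I hc) le_rfl)).aestronglyMeasurable
    exact (((hu.mono (near_right_subset_I hc)).norm.pow 2).aestronglyMeasurable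
      measurableSet_near_right).mul hr
  · refine (ae_restrict_iff' measurableSet_near_right).2 ?_
    filter_upwards [S.ae_r_pos] with x hr hx
    have hr := hr (near_right_subset_I hc hx)
    rw [norm_mul, norm_pow, norm_norm, Real.norm_of_nonneg hr.le]
    exact mul_le_mul_of_nonneg_right (h x hx) hr.le

theorem L2Near.of_lincomb {f g h : ℝ → ℂ} (hf : S.L2Near .right f) (hg : S.L2Near .right g)
    (hfc : ContinuousOn f S.I) (hgc : ContinuousOn g S.I) (hhc : ContinuousOn h S.I) {α β : ℂ}
    (hh : ∀ x ∈ S.I, h x = α * f x + β * g x) : S.L2Near .right h := by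
  obtain ⟨c, hc⟩ := S.nonempty_I
  refine l2Near_of_le (g := fun x => 2 * ‖α‖ ^ 2 * ‖f x‖ ^ 2 + 2 * ‖β‖ ^ 2 * ‖g x‖ ^ 2) hhc hc ?_
    fun x hx => ?_
  · have := ((hf.integrableOn hfc hc).const_mul (2 * ‖α‖ ^ 2)).add
      ((hg.integrableOn hgc hc).const_mul (2 * ‖β‖ ^ 2))
    refine this.congr (.of_forall fun x => ?_)
    simp only [Pi.add_apply]
    ring
  · rw [hh x (near_right_subset_I hc hx)]
    have h1 : ‖α * f x + β * g x‖ ≤ ‖α‖ * ‖f x‖ + ‖β‖ * ‖g x‖ := by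
      simpa only [norm_mul] using norm_add_le (α * f x) (β * g x)
    have h2 : ‖α * f x + β * g x‖ ^ 2 ≤ (‖α‖ * ‖f x‖ + ‖β‖ * ‖g x‖) ^ 2 := by gcongr
    nlinarith [sq_nonneg (‖α‖ * ‖f x‖ - ‖β‖ * ‖g x‖)]

theorem continuousOn_of_isPrimitiveOn {E : Type*} [NormedAddCommGroup E] [NormedSpace ℝ E]
    {f f' : ℝ → E} (h : IsPrimitiveOn f f' S.I) : ContinuousOn f S.I := fun x hx => by
  obtain ⟨ε, hε, hball⟩ := Metric.isOpen_iff.1 S.isOpen_I x hx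
  have h1 : x - ε / 2 ∈ S.I :=
    hball (by rw [Metric.mem_ball, Real.dist_eq, abs_lt]; constructor <;> linarith)
  have h2 : x + ε / 2 ∈ S.I :=
    hball (by rw [Metric.mem_ball, Real.dist_eq, abs_lt]; constructor <;> linarith)
  have := h.continuousOn_uIcc S.ordConnected_I h1 h2
  rw [uIcc_of_le (by linarith)] at this
  exact (this.continuousAt (Icc_mem_nhds (by linarith) (by linarith))).continuousWithinAt

namespace IsSol

variable {z z' : ℂ} {f f₁ g g₁ : ℝ → ℂ}

theorem continuousOn (hf : S.IsSol z f f₁) : ContinuousOn f S.I :=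
  continuousOn_of_isPrimitiveOn hf.prim

theorem exists_eq_zero_of_trivial (hf : S.IsSol z f f₁) (h0 : ∀ x ∈ S.I, f x = 0) :
    ∃ x ∈ S.I, f₁ x = 0 := by
  have h1 := ae_mem_of_forall_uIcc S.isOpen_I fun x hx y hy =>
    hf.prim.ae_hasDerivAt S.ordConnected_I hx hy
  have h2 : ∀ᵐ x, x ∈ S.I → f₁ x = 0 := by
    filter_upwards [h1, S.ae_p_pos] with x hx hp hxI
    have hz : HasDerivAt f 0 x := (hasDerivAt_const x (0 : ℂ)).congr_of_eventuallyEq <| by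
      filter_upwards [S.isOpen_I.mem_nhds hxI] with y hy using h0 y hy
    have h3 := (hx hxI).unique hz
    have hp' : (((S.p x)⁻¹ : ℝ) : ℂ) ≠ 0 := by
      exact_mod_cast (inv_pos.2 (hp hxI)).ne'
    exact (mul_eq_zero.1 h3).resolve_left hp'
  by_contra! hne
  have h3 : volume S.I = 0 := by
    refine measure_mono_null (fun x hx => ?_) (ae_iff.1 h2)
    exact fun h => hne x hx (h hx)
  exact (S.isOpen_I.measure_pos volume S.nonempty_I).ne' h3

/-- Weyl's alternative: if all solutions are square integrable near the right endpoint for one value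
of the spectral parameter, then so they are for every other value. -/
theorem l2Near_of_forall (hall : ∀ g g₁, S.IsSol z' g g₁ → S.L2Near .right g)
    (hf : S.IsSol z f f₁) : S.L2Near .right f := by
  obtain ⟨c₀, hc₀⟩ := S.nonempty_I
  obtain ⟨F⟩ := nonempty_fundamentalSystem hc₀
  set φ := F.φ z' with hφ
  set s := F.s z' with hs
  have hφS := F.φ_sol z'
  have hsS := F.s_sol z'
  set k : ℝ → ℝ := fun x => (‖φ x‖ ^ 2 + ‖s x‖ ^ 2) * S.r x with hk
  have hkint : IntegrableOn k (S.near .right c₀) :=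
    (((hall _ _ hφS).integrableOn hφS.continuousOn hc₀).add
      ((hall _ _ hsS).integrableOn hsS.continuousOn hc₀)).congr (.of_forall fun x => by
        simp only [Pi.add_apply, hk]; ring)
  have hk0 : ∀ᵐ t, t ∈ S.I → 0 ≤ k t := by
    filter_upwards [S.ae_r_pos] with t ht ht'
    have := ht ht'
    positivity
  set κ := ‖z - z'‖
  obtain ⟨c, hcn, hc⟩ := exists_tail_le hc₀ hkint hk0
    (show 0 < 1 / (8 * (κ + 1)) by positivity)
  have hcI := near_right_subset_I hc₀ hcn
  set Z₁ := wronskian f f₁ s (F.s₁ z') with hZ₁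
  set Z₂ := wronskian f f₁ φ (F.φ₁ z') with hZ₂
  have hP₁ := hf.wronskian_prim hsS
  have hP₂ := hf.wronskian_prim hφS
  have hfZ : ∀ x ∈ S.I, f x = Z₁ x * φ x - Z₂ x * s x := fun x hx => by
    have h1 := (hφS.wronskian_const hsS hx hc₀).trans (F.wronskian_eq_one z')
    simp only [hZ₁, hZ₂, wronskian] at h1 ⊢
    linear_combination (-f x) * h1
  set G : ℝ → ℝ := fun x => ‖Z₁ x‖ + ‖Z₂ x‖ with hG
  have hGc : ContinuousOn G S.I :=
    (continuousOn_of_isPrimitiveOn hP₁).norm.add (continuousOn_of_isPrimitiveOn hP₂).norm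
  have hfG : ∀ x ∈ S.I, ‖f x‖ ≤ G x * (‖φ x‖ + ‖s x‖) := fun x hx => by
    rw [hfZ x hx]
    refine (norm_sub_le _ _).trans ?_
    rw [norm_mul, norm_mul]
    simp only [hG]
    nlinarith [norm_nonneg (Z₁ x), norm_nonneg (Z₂ x), norm_nonneg (φ x), norm_nonneg (s x),
      mul_nonneg (norm_nonneg (Z₁ x)) (norm_nonneg (s x)),
      mul_nonneg (norm_nonneg (Z₂ x)) (norm_nonneg (φ x))]
  -- the coefficients of `f` with respect to `φ`, `s` are bounded by twice their value at `c`
  have hbound : ∀ y ∈ S.near .right c, G y ≤ 2 * G c := by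
    intro y hy
    have hsub : Icc c y ⊆ S.I := (Icc_subset_near_right (self_mem_near_right hcI) hy).trans
      (near_right_subset_I hcI)
    obtain ⟨m, hm, hmax⟩ := isCompact_Icc.exists_isMaxOn (nonempty_Icc.2 hy.1) (hGc.mono hsub)
    have hGm : 0 ≤ G m := by positivity
    have hmn := Icc_subset_near_right (self_mem_near_right hcI) hy hm
    have hmI := hsub hm
    have hki : IntervalIntegrable k volume c m :=
      intervalIntegrable_of_near_right hkint hcn (near_right_antitone hcn.1 hmn)
    have hd : ∀ v : ℝ → ℂ, ∀ V : ℝ → ℂ, (∀ x, ‖v x‖ ≤ ‖φ x‖ + ‖s x‖) →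
        IsPrimitiveOn V (fun x => (z - z') * (S.r x * (f x * v x))) S.I →
        ‖V m‖ ≤ ‖V c‖ + κ * (2 * G m) * (1 / (8 * (κ + 1))) := by
      intro v V hv hV
      have h1 : ‖V m - V c‖ ≤ ∫ t in c..m, κ * (2 * G m) * k t := by
        rw [← (hV c hcI m hmI).2]
        refine intervalIntegral.norm_integral_le_of_norm_le hm.1 ?_ (hki.const_mul _)
        filter_upwards [S.ae_r_pos] with t hr ht
        have ht' : t ∈ Icc c y := ⟨ht.1.le, ht.2.trans hm.2⟩
        have hr := hr (hsub ht')
        have hft : ‖f t‖ ≤ G m * (‖φ t‖ + ‖s t‖) :=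
          (hfG t (hsub ht')).trans (mul_le_mul_of_nonneg_right (hmax ht') (by positivity))
        rw [norm_mul, norm_mul, norm_mul, Complex.norm_of_nonneg hr.le]
        calc κ * (S.r t * (‖f t‖ * ‖v t‖))
            ≤ κ * (S.r t * (G m * (‖φ t‖ + ‖s t‖) * (‖φ t‖ + ‖s t‖))) := by
              gcongr; exact hv t
          _ ≤ κ * (S.r t * (G m * (2 * (‖φ t‖ ^ 2 + ‖s t‖ ^ 2)))) := by
              rw [mul_assoc (G m)]
              refine mul_le_mul_of_nonneg_left (mul_le_mul_of_nonneg_left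
                (mul_le_mul_of_nonneg_left ?_ hGm) hr.le) (norm_nonneg _)
              nlinarith [sq_nonneg (‖φ t‖ - ‖s t‖)]
          _ = κ * (2 * G m) * k t := by simp only [hk]; ring
      rw [intervalIntegral.integral_const_mul] at h1
      have h2 : κ * (2 * G m) * ∫ t in c..m, k t ≤ κ * (2 * G m) * (1 / (8 * (κ + 1))) := by
        gcongr; exact hc m hmn
      have h3 := norm_le_norm_add_norm_sub' (V m) (V c)
      linarith
    have e1 := hd s Z₁ (fun x => by linarith [norm_nonneg (φ x)]) hP₁
    have e2 := hd φ Z₂ (fun x => by linarith [norm_nonneg (s x)]) hP₂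
    have e3 : κ * (2 * G m) * (1 / (8 * (κ + 1))) ≤ G m / 4 := by
      have : κ / (κ + 1) ≤ 1 := by rw [div_le_one (by positivity)]; linarith
      have e : κ * (2 * G m) * (1 / (8 * (κ + 1))) = G m / 4 * (κ / (κ + 1)) := by
        field_simp; ring
      rw [e]
      nlinarith
    have e4 : G y ≤ G m := hmax ⟨hy.1, le_rfl⟩
    have e5 : G m = ‖Z₁ m‖ + ‖Z₂ m‖ := rfl
    have e6 : G c = ‖Z₁ c‖ + ‖Z₂ c‖ := rfl
    linarith
  refine l2Near_of_le (g := fun x => 8 * G c ^ 2 * (‖φ x‖ ^ 2 + ‖s x‖ ^ 2)) hf.continuousOn hcI ?_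
    fun x hx => ?_
  · refine ((hkint.mono_set (near_right_antitone hcn.1)).const_mul (8 * G c ^ 2)).congr
      (.of_forall fun x => ?_)
    simp only [hk]; ring
  · have h1 := hfG x (near_right_subset_I hcI hx)
    have h2 := hbound x hx
    have h3 : ‖f x‖ ≤ 2 * G c * (‖φ x‖ + ‖s x‖) :=
      h1.trans (mul_le_mul_of_nonneg_right h2 (by positivity))
    have h4 : ‖f x‖ ^ 2 ≤ (2 * G c * (‖φ x‖ + ‖s x‖)) ^ 2 := by gcongr
    have h5 : (‖φ x‖ + ‖s x‖) ^ 2 ≤ 2 * (‖φ x‖ ^ 2 + ‖s x‖ ^ 2) := by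
      nlinarith [sq_nonneg (‖φ x‖ - ‖s x‖)]
    calc _ ≤ _ := h4
      _ = 4 * G c ^ 2 * (‖φ x‖ + ‖s x‖) ^ 2 := by ring
      _ ≤ 4 * G c ^ 2 * (2 * (‖φ x‖ ^ 2 + ‖s x‖ ^ 2)) := by gcongr
      _ = _ := by ring

end IsSol

theorem LimitPoint.exists_not_l2Near (h : S.LimitPoint .right) (z : ℂ) :
    ∃ f f₁, S.IsSol z f f₁ ∧ ¬ S.L2Near .right f := by
  obtain ⟨z₀, -, ψ, -, huniq⟩ := h
  by_contra! hall
  obtain ⟨c, hc⟩ := S.nonempty_I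
  obtain ⟨F⟩ := nonempty_fundamentalSystem hc
  obtain ⟨k₁, hk₁⟩ := huniq _ (F.φ_sol z₀).isSolution ((F.φ_sol z₀).l2Near_of_forall hall)
  obtain ⟨k₂, hk₂⟩ := huniq _ (F.s_sol z₀).isSolution ((F.s_sol z₀).l2Near_of_forall hall)
  have h1 := hk₁ c hc
  have h2 := hk₂ c hc
  rw [F.φ_c] at h1
  rw [F.s_c] at h2
  have hk₂0 : k₂ = 0 := (mul_eq_zero.1 h2.symm).resolve_right fun h => by simp [h] at h1
  have hs0 : ∀ x ∈ S.I, F.s z₀ x = 0 := fun x hx => by rw [hk₂ x hx, hk₂0, zero_mul]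
  obtain ⟨x, hx, hx0⟩ := (F.s_sol z₀).exists_eq_zero_of_trivial hs0
  have := ((F.s_sol z₀).eq_zero_of_eq_zero hx (hs0 x hx) hx0 hc).2
  rw [F.s₁_c] at this
  exact one_ne_zero this

/-- In the limit point case, any two square integrable solutions are linearly dependent. -/
theorem LimitPoint.wronskian_eq_zero (h : S.LimitPoint .right) {z : ℂ} {f f₁ g g₁ : ℝ → ℂ}
    (hf : S.IsSol z f f₁) (hg : S.IsSol z g g₁) (hf2 : S.L2Near .right f)
    (hg2 : S.L2Near .right g) {x : ℝ} (hx : x ∈ S.I) : wronskian f f₁ g g₁ x = 0 := by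
  obtain ⟨k, k₁, hk, hk2⟩ := h.exists_not_l2Near z
  by_contra hW
  refine hk2 (hf2.of_lincomb hg2 hf.continuousOn hg.continuousOn hk.continuousOn
    (α := wronskian k k₁ g g₁ x / wronskian f f₁ g g₁ x)
    (β := -wronskian k k₁ f f₁ x / wronskian f f₁ g g₁ x) fun y hy => ?_)
  have := (hf.wronskian_mul_eq hg hk hy hx).1
  field_simp
  linear_combination this

end SturmLiouville

/-! ### The energy identity below a nonoscillatory parameter -/

namespace SturmLiouville

/-- A lower bound for `|A - ζ B|`, obtained from `|α| |A - ζ B| ≥ Re (α (A - ζ B))` with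
`α = |ζ| - conj ζ`: one has `Re α > 0` and `Re (α ζ) < 0` unless `ζ ≥ 0`. -/
theorem coercive {A B : ℝ} {ζ N : ℂ} (h : (A : ℂ) - ζ * B = N) :
    (‖ζ‖ - ζ.re) * (A + ‖ζ‖ * B) ≤ 2 * ‖ζ‖ * ‖N‖ := by
  have h1 : ((‖ζ‖ : ℂ) - (starRingEnd ℂ) ζ) * N =
      ((‖ζ‖ : ℂ) - (starRingEnd ℂ) ζ) * A - (‖ζ‖ * ζ - (‖ζ‖ : ℂ) ^ 2) * B := by
    rw [← h, ← Complex.conj_mul']; ring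
  have h2 : (((‖ζ‖ : ℂ) - (starRingEnd ℂ) ζ) * N).re = (‖ζ‖ - ζ.re) * (A + ‖ζ‖ * B) := by
    rw [h1]
    simp [← Complex.ofReal_pow]
    ring
  rw [← h2]
  refine (Complex.re_le_norm _).trans ?_
  rw [norm_mul]
  gcongr
  refine (norm_sub_le _ _).trans ?_
  simp only [Complex.norm_real, norm_norm, RCLike.norm_conj]
  linarith

theorem mem_slit_iff {Λ : ℝ} {z : ℂ} : z ∈ slit Λ ↔ 0 < ‖z - Λ‖ - (z - Λ).re := by
  have hle := Complex.re_le_norm (z - Λ)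
  rw [sub_pos, lt_iff_le_and_ne, and_iff_right hle]
  refine not_congr ⟨?_, fun h => ?_⟩
  · rintro ⟨t, ht, rfl⟩
    rw [← Complex.ofReal_sub, Complex.ofReal_re, Complex.norm_of_nonneg (sub_nonneg.2 ht)]
  · have h0 : 0 ≤ (z - Λ).re := h ▸ norm_nonneg _
    have him : (z - Λ).im = 0 := Complex.abs_re_eq_norm.1 (by rw [abs_of_nonneg h0, h])
    simp only [Complex.sub_re, Complex.ofReal_re, Complex.sub_im, Complex.ofReal_im] at h0 him
    exact ⟨z.re, by linarith, Complex.ext (by simp) (by simpa using him)⟩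

theorem isOpen_slit (Λ : ℝ) : IsOpen (slit Λ) := by
  have : slit Λ = {z : ℂ | 0 < ‖z - Λ‖ - (z - Λ).re} := ext fun z => mem_slit_iff
  rw [this]
  exact isOpen_lt continuous_const (by fun_prop)

/-- A real solution `w` of `ℓ w = Λ w` without zeros in `[c, b)`. -/
structure NonvanishingSol (S : SturmLiouville) (Λ c : ℝ) where
  w : ℝ → ℝ
  w₁ : ℝ → ℝ
  sol : S.IsSol Λ w w₁
  mem : c ∈ S.I
  ne_zero : ∀ x ∈ S.near .right c, w x ≠ 0

namespace NonvanishingSol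

variable {S : SturmLiouville} {Λ c : ℝ} (P : S.NonvanishingSol Λ c)

/-- The Wronskian of the nonvanishing solution `w` with the pair `(u, u₁)`; it equals
`p w² (u / w)'`. -/
noncomputable def W (u u₁ : ℝ → ℂ) : ℝ → ℂ :=
  wronskian (fun x => (P.w x : ℂ)) (fun x => (P.w₁ x : ℂ)) u u₁

/-- The density `p w² |(u / w)'|²`. -/
noncomputable def dA (u u₁ : ℝ → ℂ) (x : ℝ) : ℝ := (S.p x)⁻¹ * (‖P.W u u₁ x‖ ^ 2 / P.w x ^ 2)

/-- The density `r |u|²`. -/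
noncomputable def _root_.SturmLiouville.dB (S : SturmLiouville) (u : ℝ → ℂ) (x : ℝ) : ℝ :=
  S.r x * ‖u x‖ ^ 2

variable {z z' : ℂ} {u u₁ v v₁ : ℝ → ℂ} {x y : ℝ}

theorem _root_.SturmLiouville.intervalIntegrable_dB (hu : ContinuousOn u S.I) (hx : x ∈ S.I)
    (hy : y ∈ S.I) : IntervalIntegrable (S.dB u) volume x y :=
  (intervalIntegrable_r hx hy).mul_continuousOn ((hu.mono (uIcc_subset_I hx hy)).norm.pow 2)

theorem continuousOn_W (hu : S.IsSol z u u₁) : ContinuousOn (P.W u u₁) S.I :=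
  continuousOn_of_isPrimitiveOn (P.sol.ofReal.wronskian_prim hu)

theorem near_subset (P : S.NonvanishingSol Λ c) : S.near .right c ⊆ S.I :=
  near_right_subset_I P.mem

theorem continuousOn_w : ContinuousOn P.w S.I := continuousOn_of_isPrimitiveOn P.sol.prim

theorem intervalIntegrable_dA (hu : S.IsSol z u u₁) (hx : x ∈ S.near .right c)
    (hy : y ∈ S.near .right c) : IntervalIntegrable (P.dA u u₁) volume x y := by
  have hsub := ordConnected_near_right.uIcc_subset hx hy
  refine (intervalIntegrable_p_inv (P.near_subset hx) (P.near_subset hy)).mul_continuousOn ?_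
  exact (((P.continuousOn_W hu).mono (hsub.trans P.near_subset)).norm.pow 2).div
    ((P.continuousOn_w.mono (hsub.trans P.near_subset)).pow 2)
    fun t ht => pow_ne_zero 2 (P.ne_zero t (hsub ht))

theorem ae_dA_nonneg : ∀ᵐ x, x ∈ S.I → 0 ≤ P.dA u u₁ x := by
  filter_upwards [S.ae_p_pos] with x hp hx
  have := hp hx
  unfold dA
  positivity

theorem _root_.SturmLiouville.ae_dB_nonneg : ∀ᵐ x, x ∈ S.I → 0 ≤ S.dB u x := by
  filter_upwards [S.ae_r_pos] with x hp hx
  have := hp hx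
  unfold dB
  positivity

/-- The Jacobi form of the equation: `W(w, u) = p w² (u / w)'` has derivative
`-(z - Λ) r w² (u / w)`; it is multiplied here by `v / w`. -/
theorem energy_prim (hu : S.IsSol z u u₁)
    (hv : IsPrimitiveOn v (fun x => ((S.p x)⁻¹ : ℝ) * v₁ x) S.I) :
    IsPrimitiveOn (fun x => P.W u u₁ x * (v x * (P.w x : ℂ)⁻¹))
      (fun x => ((S.p x)⁻¹ : ℝ) * (P.W u u₁ x * P.W v v₁ x / (P.w x : ℂ) ^ 2) -
        (z - Λ) * (S.r x * (u x * v x))) (S.near .right c) := by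
  have hJ := ordConnected_near_right (S := S) (c := c)
  have h0 : ∀ x ∈ S.near .right c, (P.w x : ℂ) ≠ 0 := fun x hx =>
    Complex.ofReal_ne_zero.2 (P.ne_zero x hx)
  have hW := (P.sol.ofReal.wronskian_prim hu).mono P.near_subset
  have hwi := (P.sol.ofReal.prim.mono P.near_subset).inv hJ h0
  refine (hW.mul hJ ((hv.mono P.near_subset).mul hJ hwi)).congr hJ (fun _ _ => rfl) fun x hx => ?_
  have := h0 x hx
  simp only [W, wronskian, Complex.coe_algebraMap]
  field_simp
  ring

theorem energy_identity (hu : S.IsSol z u u₁) (hx : x ∈ S.near .right c)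
    (hy : y ∈ S.near .right c) :
    ((∫ t in x..y, P.dA u u₁ t : ℝ) : ℂ) - (z - Λ) * (∫ t in x..y, S.dB u t : ℝ) =
      P.W u u₁ y * ((starRingEnd ℂ) (u y) * (P.w y : ℂ)⁻¹) -
        P.W u u₁ x * ((starRingEnd ℂ) (u x) * (P.w x : ℂ)⁻¹) := by
  have hconj : IsPrimitiveOn (fun x => (starRingEnd ℂ) (u x))
      (fun x => ((S.p x)⁻¹ : ℝ) * (starRingEnd ℂ) (u₁ x)) S.I :=
    (hu.prim.clm Complex.conjCLE.toContinuousLinearMap).congr S.ordConnected_I (fun _ _ => rfl)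
      fun x _ => by simp
  obtain ⟨h1, h2⟩ := P.energy_prim hu hconj x hx y hy
  rw [← h2, ← intervalIntegral.integral_ofReal, ← intervalIntegral.integral_ofReal,
    ← intervalIntegral.integral_const_mul, ← intervalIntegral.integral_sub]
  · refine intervalIntegral.integral_congr fun t _ => ?_
    have e1 : P.W (fun x => (starRingEnd ℂ) (u x)) (fun x => (starRingEnd ℂ) (u₁ x)) t =
        (starRingEnd ℂ) (P.W u u₁ t) := by
      simp [W, wronskian]
    simp only [e1, Complex.mul_conj', dA, dB]
    push_cast
    ring
  · exact ⟨(P.intervalIntegrable_dA hu hx hy).1.ofReal, (P.intervalIntegrable_dA hu hx hy).2.ofReal⟩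
  · have := intervalIntegrable_dB hu.continuousOn (P.near_subset hx) (P.near_subset hy)
    exact IntervalIntegrable.const_mul ⟨this.1.ofReal, this.2.ofReal⟩ _

theorem integral_dA_nonneg (hx : x ∈ S.near .right c) (hy : y ∈ S.near .right c) (hxy : x ≤ y) :
    0 ≤ ∫ t in x..y, P.dA u u₁ t := by
  refine intervalIntegral.integral_nonneg_of_ae_restrict hxy ?_
  refine (ae_restrict_iff' measurableSet_Icc).2 ?_
  filter_upwards [P.ae_dA_nonneg] with t ht ht'
  exact ht (P.near_subset (Icc_subset_near_right hx hy ht'))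

theorem _root_.SturmLiouville.integral_dB_nonneg (hx : x ∈ S.I) (hy : y ∈ S.I) (hxy : x ≤ y) :
    0 ≤ ∫ t in x..y, S.dB u t := by
  refine intervalIntegral.integral_nonneg_of_ae_restrict hxy ?_
  refine (ae_restrict_iff' measurableSet_Icc).2 ?_
  filter_upwards [S.ae_dB_nonneg] with t ht ht'
  exact ht (S.ordConnected_I.out hx hy ht')

/-- For `z` off `[Λ, ∞)`, a solution of `ℓ u = z u` with two zeros in `[c, b)` is trivial. -/
theorem eq_zero_of_two_zeros (P : S.NonvanishingSol Λ c) (hz : z ∈ slit Λ)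
    (hu : S.IsSol z u u₁) (hx : x ∈ S.near .right c)
    (hy : y ∈ S.near .right c) (hxy : x < y) (hux : u x = 0) (huy : u y = 0) {t : ℝ}
    (ht : t ∈ S.I) : u t = 0 ∧ u₁ t = 0 := by
  have hE := P.energy_identity hu hx hy
  rw [hux, huy] at hE
  have hco := coercive hE
  simp only [map_zero, zero_mul, mul_zero, sub_self, norm_zero] at hco
  have hδ := mem_slit_iff.1 hz
  have hζ : 0 < ‖z - Λ‖ := norm_pos_iff.2 fun h => by simp [h] at hδ
  have hA0 := P.integral_dA_nonneg (u := u) (u₁ := u₁) hx hy hxy.le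
  have hB0 := integral_dB_nonneg (u := u) (P.near_subset hx) (P.near_subset hy) hxy.le
  have hsum := nonpos_of_mul_nonpos_right hco hδ
  have hA : ∫ t in x..y, P.dA u u₁ t = 0 := by nlinarith [mul_nonneg hζ.le hB0]
  have hB : ∫ t in x..y, S.dB u t = 0 := by
    have : ‖z - Λ‖ * ∫ t in x..y, S.dB u t = 0 := by linarith [mul_nonneg hζ.le hB0]
    exact (mul_eq_zero.1 this).resolve_left hζ.ne'
  have hsub : Ioc x y ⊆ S.near .right c := Ioc_subset_Icc_self.trans (Icc_subset_near_right hx hy)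
  have hmem : ∀ᵐ t ∂(volume.restrict (Ioc x y)), t ∈ Ioc x y := ae_restrict_mem measurableSet_Ioc
  have e1 : ∀ᵐ t ∂(volume.restrict (Ioc x y)), P.dA u u₁ t = 0 := by
    refine (intervalIntegral.integral_eq_zero_iff_of_le_of_nonneg_ae hxy.le ?_
      (P.intervalIntegrable_dA hu hx hy)).1 hA
    filter_upwards [ae_restrict_of_ae (P.ae_dA_nonneg (u := u) (u₁ := u₁)), hmem] with t h1 h2
    exact h1 (P.near_subset (hsub h2))
  have e2 : ∀ᵐ t ∂(volume.restrict (Ioc x y)), S.dB u t = 0 := by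
    refine (intervalIntegral.integral_eq_zero_iff_of_le_of_nonneg_ae hxy.le ?_
      (intervalIntegrable_dB hu.continuousOn (P.near_subset hx) (P.near_subset hy))).1 hB
    filter_upwards [ae_restrict_of_ae (S.ae_dB_nonneg (u := u)), hmem] with t h1 h2
    exact h1 (P.near_subset (hsub h2))
  have hne : (ae (volume.restrict (Ioc x y))).NeBot := by
    rw [ae_neBot, Ne, Measure.restrict_eq_zero, Real.volume_Ioc]
    simpa using hxy
  obtain ⟨τ, hτ, hτ1, hτ2, hp, hr⟩ := (hmem.and (e1.and (e2.and
    ((ae_restrict_of_ae S.ae_p_pos).and (ae_restrict_of_ae S.ae_r_pos))))).exists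
  have hτJ := hsub hτ
  have hτI := P.near_subset hτJ
  have hw0 := P.ne_zero τ hτJ
  have hu0 : u τ = 0 := by
    have := hr hτI
    simpa [dB, this.ne'] using hτ2
  have hu1 : u₁ τ = 0 := by
    have := hp hτI
    simpa [dA, this.ne', hw0, W, wronskian, hu0] using hτ1
  exact hu.eq_zero_of_eq_zero hτI hu0 hu1 ht

/-- The energy of the solution `u` on `[c, y]` with boundary values `1` and `0` is controlled by
that of any comparison function `v` which has the boundary values `1` and `0` on a smaller
interval `[c, y₀]`: both energies pair `u` to the same boundary term `N`. -/
theorem energy_bound (hz : z ∈ slit Λ) (hu : S.IsSol z u u₁) (hv : S.IsSol z' v v₁) {y₀ : ℝ}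
    (hy₀ : y₀ ∈ S.near .right c) (hy : y ∈ S.near .right c) (hyy : y₀ ≤ y) (huc : u c = 1)
    (huy : u y = 0) (hvc : v c = 1) (hvy : v y₀ = 0) :
    ‖u₁ c - P.w₁ c / P.w c‖ ≤ 2 * ‖z - Λ‖ / (‖z - Λ‖ - (z - Λ).re) *
      ((∫ t in c..y₀, P.dA v v₁ t) + ‖z - Λ‖ * ∫ t in c..y₀, S.dB v t) ∧
    ∫ t in c..y, S.dB u t ≤ 2 / (‖z - Λ‖ - (z - Λ).re) * ‖u₁ c - P.w₁ c / P.w c‖ := by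
  set ζ := z - Λ with hζdef
  set N := u₁ c - P.w₁ c / P.w c with hN
  have hδ : 0 < ‖ζ‖ - ζ.re := mem_slit_iff.1 hz
  have hζ : 0 < ‖ζ‖ := norm_pos_iff.2 fun h => by simp [h] at hδ
  have hc := self_mem_near_right P.mem
  have hw0 : (P.w c : ℂ) ≠ 0 := Complex.ofReal_ne_zero.2 (P.ne_zero c hc)
  have hWc : P.W u u₁ c * (P.w c : ℂ)⁻¹ = N := by
    simp only [W, wronskian, huc, hN]
    field_simp
  have hE := P.energy_identity hu hc hy
  rw [huc, huy, map_zero, map_one, zero_mul, mul_zero, zero_sub, one_mul, hWc] at hE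
  have hco := coercive hE
  rw [norm_neg] at hco
  obtain ⟨hi, hE'⟩ := P.energy_prim hu hv.prim c hc y₀ hy₀
  simp only [hvc, hvy, one_mul, zero_mul, mul_zero, zero_sub, hWc] at hE'
  set A := ∫ t in c..y, P.dA u u₁ t with hA
  set B := ∫ t in c..y, S.dB u t with hB
  have hA0 : 0 ≤ A := P.integral_dA_nonneg hc hy hy.1
  have hB0 : 0 ≤ B := integral_dB_nonneg P.mem (P.near_subset hy) hy.1
  constructor
  · set ε := (‖ζ‖ - ζ.re) / (4 * ‖ζ‖) with hε
    have hε0 : 0 < ε := by positivity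
    have iAu := P.intervalIntegrable_dA hu hc hy₀
    have iAv := P.intervalIntegrable_dA hv hc hy₀
    have iBu := intervalIntegrable_dB hu.continuousOn P.mem (P.near_subset hy₀)
    have iBv := intervalIntegrable_dB hv.continuousOn P.mem (P.near_subset hy₀)
    have iu := (iAu.add (iBu.const_mul ‖ζ‖)).const_mul ε
    have iv := (iAv.add (iBv.const_mul ‖ζ‖)).const_mul (1 / (4 * ε))
    have hle : ‖N‖ ≤ ∫ t in c..y₀, (ε * (P.dA u u₁ t + ‖ζ‖ * S.dB u t) +
        1 / (4 * ε) * (P.dA v v₁ t + ‖ζ‖ * S.dB v t)) := by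
      rw [← norm_neg, ← hE']
      refine intervalIntegral.norm_integral_le_of_norm_le hy₀.1 ?_ (iu.add iv)
      filter_upwards [S.ae_p_pos, S.ae_r_pos] with t hp hr ht
      have htI : t ∈ S.I :=
        P.near_subset (Icc_subset_near_right hc hy₀ (Ioc_subset_Icc_self ht))
      have hp := inv_pos.2 (hp htI)
      have hr := hr htI
      -- `a b ≤ ε a² + b² / (4 ε)`
      have amgm : ∀ a b : ℝ, a * b ≤ ε * a ^ 2 + 1 / (4 * ε) * b ^ 2 := fun a b => by
        have h1 : ε * a ^ 2 + 1 / (4 * ε) * b ^ 2 - a * b = (2 * ε * a - b) ^ 2 / (4 * ε) := by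
          field_simp; ring
        have h2 : 0 ≤ (2 * ε * a - b) ^ 2 / (4 * ε) := by positivity
        linarith
      refine (norm_sub_le _ _).trans ?_
      rw [norm_mul, norm_div, norm_mul, norm_mul, norm_mul, norm_mul, norm_pow,
        Complex.norm_of_nonneg hp.le, Complex.norm_of_nonneg hr.le, Complex.norm_real,
        Real.norm_eq_abs, sq_abs]
      have h1 : (S.p t)⁻¹ * (‖P.W u u₁ t‖ * ‖P.W v v₁ t‖ / P.w t ^ 2) ≤
          (S.p t)⁻¹ * ((ε * ‖P.W u u₁ t‖ ^ 2 + 1 / (4 * ε) * ‖P.W v v₁ t‖ ^ 2) / P.w t ^ 2) := by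
        gcongr; exact amgm _ _
      have h2 : ‖ζ‖ * (S.r t * (‖u t‖ * ‖v t‖)) ≤
          ‖ζ‖ * (S.r t * (ε * ‖u t‖ ^ 2 + 1 / (4 * ε) * ‖v t‖ ^ 2)) := by
        gcongr; exact amgm _ _
      refine (add_le_add h1 h2).trans (le_of_eq ?_)
      simp only [dA, dB]
      ring
    rw [intervalIntegral.integral_add iu iv, intervalIntegral.integral_const_mul,
      intervalIntegral.integral_const_mul,
      intervalIntegral.integral_add iAu (iBu.const_mul _),
      intervalIntegral.integral_add iAv (iBv.const_mul _), intervalIntegral.integral_const_mul,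
      intervalIntegral.integral_const_mul] at hle
    have hAle : ∫ t in c..y₀, P.dA u u₁ t ≤ A := by
      rw [hA, ← intervalIntegral.integral_add_adjacent_intervals iAu
        (P.intervalIntegrable_dA hu hy₀ hy)]
      linarith [P.integral_dA_nonneg (u := u) (u₁ := u₁) hy₀ hy hyy]
    have hBle : ∫ t in c..y₀, S.dB u t ≤ B := by
      rw [hB, ← intervalIntegral.integral_add_adjacent_intervals iBu
        (intervalIntegrable_dB hu.continuousOn (P.near_subset hy₀) (P.near_subset hy))]
      linarith [integral_dB_nonneg (u := u) (P.near_subset hy₀) (P.near_subset hy) hyy]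
    have h3 : ε * ((∫ t in c..y₀, P.dA u u₁ t) + ‖ζ‖ * ∫ t in c..y₀, S.dB u t) ≤ ‖N‖ / 2 := by
      have h4 : ε * ((∫ t in c..y₀, P.dA u u₁ t) + ‖ζ‖ * ∫ t in c..y₀, S.dB u t) ≤
          ε * (A + ‖ζ‖ * B) := by gcongr
      refine h4.trans ?_
      rw [hε, div_mul_eq_mul_div, div_le_iff₀ (by positivity)]
      linarith
    have h5 : 1 / (4 * ε) = ‖ζ‖ / (‖ζ‖ - ζ.re) := by rw [hε]; field_simp
    rw [h5] at hle
    have h6 : 2 * ‖ζ‖ / (‖ζ‖ - ζ.re) = 2 * (‖ζ‖ / (‖ζ‖ - ζ.re)) := by ring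
    rw [h6]
    linarith
  · rw [div_mul_eq_mul_div, le_div_iff₀ hδ]
    have : ‖ζ‖ * ((‖ζ‖ - ζ.re) * B) ≤ ‖ζ‖ * (2 * ‖N‖) := by
      nlinarith [mul_nonneg hδ.le hA0]
    have := le_of_mul_le_mul_left this hζ
    linarith

/-- Below `Λ` the functions `φ(z, y) / s(z, y)` and the norms of the corresponding solutions
`φ - (φ / s)(y) s` that vanish at `y` are bounded as `y` tends to the endpoint, locally uniformly
in `z`. -/
theorem exists_weyl_bound (P : S.NonvanishingSol Λ c) (F : S.FundamentalSystem c) {y₀ : ℝ}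
    (hy₀ : y₀ ∈ S.near .right c)
    (hcy : c < y₀) : ∃ K K' : ℂ → ℝ, ContinuousOn K (slit Λ) ∧
      ∀ z ∈ slit Λ, ∀ y ∈ S.near .right c, y₀ ≤ y → F.s z y ≠ 0 ∧ ‖F.φ z y / F.s z y‖ ≤ K z ∧
        ∫ t in c..y, S.dB (fun x => F.φ z x - F.φ z y / F.s z y * F.s z x) t ≤ K' z := by
  have hc := self_mem_near_right P.mem
  have hs : ∀ z ∈ slit Λ, ∀ y ∈ S.near .right c, c < y → F.s z y ≠ 0 := fun z hz y hy hcy h0 => by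
    have := (P.eq_zero_of_two_zeros hz (F.s_sol z) hc hy hcy (F.s_c z) h0 P.mem).2
    rw [F.s₁_c] at this
    exact one_ne_zero this
  -- the comparison function is a solution for the parameter `Λ - 1`
  have hz' : ((Λ : ℂ) - 1) ∈ slit Λ := by rw [mem_slit_iff]; norm_num
  set z' : ℂ := Λ - 1
  have hv := (F.φ_sol z').sub ((F.s_sol z').const_mul (F.φ z' y₀ / F.s z' y₀))
  have hvc : F.φ z' c - F.φ z' y₀ / F.s z' y₀ * F.s z' c = 1 := by simp [F.φ_c, F.s_c]
  have hvy : F.φ z' y₀ - F.φ z' y₀ / F.s z' y₀ * F.s z' y₀ = 0 := by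
    rw [div_mul_cancel₀ _ (hs z' hz' y₀ hy₀ hcy), sub_self]
  set Av := ∫ t in c..y₀, P.dA (fun x => F.φ z' x - F.φ z' y₀ / F.s z' y₀ * F.s z' x)
    (fun x => F.φ₁ z' x - F.φ z' y₀ / F.s z' y₀ * F.s₁ z' x) t
  set Bv := ∫ t in c..y₀, S.dB (fun x => F.φ z' x - F.φ z' y₀ / F.s z' y₀ * F.s z' x) t
  set K₀ : ℂ → ℝ := fun z => 2 * ‖z - Λ‖ / (‖z - Λ‖ - (z - Λ).re) * (Av + ‖z - Λ‖ * Bv) with hK₀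
  refine ⟨fun z => K₀ z + ‖(P.w₁ c / P.w c : ℂ)‖, fun z => 2 / (‖z - Λ‖ - (z - Λ).re) * K₀ z,
    ?_, fun z hz y hy hyy => ?_⟩
  · refine ContinuousOn.add (ContinuousOn.mul (ContinuousOn.div (by fun_prop) (by fun_prop)
      fun z hz => ?_) (by fun_prop)) continuousOn_const
    exact (mem_slit_iff.1 hz).ne'
  · have hsy := hs z hz y hy (hcy.trans_le hyy)
    have hu := (F.φ_sol z).sub ((F.s_sol z).const_mul (F.φ z y / F.s z y))
    obtain ⟨h1, h2⟩ := P.energy_bound hz hu hv hy₀ hy hyy (by simp [F.φ_c, F.s_c])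
      (by rw [div_mul_cancel₀ _ hsy, sub_self]) hvc hvy
    refine ⟨hsy, ?_, h2.trans ?_⟩
    · simp only [F.φ₁_c, F.s₁_c, mul_one, zero_sub] at h1
      have h3 : F.φ z y / F.s z y =
          -(-(F.φ z y / F.s z y) - P.w₁ c / P.w c) - P.w₁ c / P.w c := by ring
      rw [h3]
      refine (norm_sub_le _ _).trans ?_
      rw [norm_neg]
      exact add_le_add_left h1 _
    · have := mem_slit_iff.1 hz
      exact mul_le_mul_of_nonneg_left h1 (by positivity)

end NonvanishingSol
end SturmLiouville

/-! ### The Weyl function -/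

/-- A pointwise limit of locally bounded holomorphic functions is holomorphic: the Cauchy formula
passes to the limit by dominated convergence. -/
theorem differentiableOn_of_tendsto_of_bound {U : Set ℂ} (hU : IsOpen U) {F : ℕ → ℂ → ℂ}
    {f : ℂ → ℂ} {K : ℂ → ℝ} (hF : ∀ n, DifferentiableOn ℂ (F n) U) (hK : ContinuousOn K U)
    (hb : ∀ n, ∀ z ∈ U, ‖F n z‖ ≤ K z)
    (hlim : ∀ z ∈ U, Filter.Tendsto (fun n => F n z) Filter.atTop (nhds (f z))) :
    DifferentiableOn ℂ f U := by
  intro z₀ hz₀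
  obtain ⟨R, hR, hball⟩ := Metric.nhds_basis_closedBall.mem_iff.1 (hU.mem_nhds hz₀)
  obtain ⟨M, hM⟩ := (isCompact_closedBall z₀ R).exists_bound_of_continuousOn (hK.mono hball)
  have hbM : ∀ n, ∀ z ∈ Metric.closedBall z₀ R, ‖F n z‖ ≤ M := fun n z hz =>
    (hb n z (hball hz)).trans ((le_abs_self _).trans (hM z hz))
  have hmem : ∀ θ, circleMap z₀ R θ ∈ Metric.closedBall z₀ R := fun θ =>
    Metric.sphere_subset_closedBall (circleMap_mem_sphere z₀ hR.le θ)
  have hFcont : ∀ n, Continuous fun θ => F n (circleMap z₀ R θ) := fun n =>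
    (hF n).continuousOn.comp_continuous (continuous_circleMap z₀ R) fun θ => hball (hmem θ)
  have hfmeas : StronglyMeasurable fun θ => f (circleMap z₀ R θ) :=
    stronglyMeasurable_of_tendsto Filter.atTop (fun n => (hFcont n).stronglyMeasurable)
      (tendsto_pi_nhds.2 fun θ => hlim _ (hball (hmem θ)))
  have hfint : CircleIntegrable f z₀ R := by
    refine (intervalIntegrable_const (c := M)).mono_fun' hfmeas.aestronglyMeasurable
      (.of_forall fun θ => ?_)
    exact le_of_tendsto (hlim _ (hball (hmem θ))).norm (.of_forall fun n => hbM n _ (hmem θ))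
  lift R to NNReal using hR.le
  have hps := hasFPowerSeriesOn_cauchy_integral hfint (by exact_mod_cast hR)
  have hd := hps.differentiableOn
  rw [Metric.eball_coe] at hd
  have heq : ∀ w ∈ Metric.ball z₀ (R : ℝ),
      f w = (2 * Real.pi * Complex.I : ℂ)⁻¹ • ∮ z in C(z₀, R), (z - w)⁻¹ • f z := by
    intro w hw
    have hne : ∀ θ, circleMap z₀ R θ - w ≠ 0 := fun θ => by
      refine sub_ne_zero.2 fun h => ?_
      have := circleMap_mem_sphere z₀ hR.le θ
      rw [h, mem_sphere_iff_norm] at this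
      rw [mem_ball_iff_norm] at hw
      exact hw.ne this
    have hcinv : Continuous fun θ => (circleMap z₀ R θ - w)⁻¹ :=
      ((continuous_circleMap z₀ R).sub continuous_const).inv₀ hne
    have hcd : Continuous (deriv (circleMap z₀ R)) := by
      have : deriv (circleMap z₀ R) = fun θ => circleMap 0 R θ * Complex.I :=
        funext fun θ => deriv_circleMap _ _ _
      rw [this]
      exact (continuous_circleMap 0 R).mul continuous_const
    have h1 : Filter.Tendsto (fun n => ∮ z in C(z₀, R), (z - w)⁻¹ • F n z) Filter.atTop
        (nhds (∮ z in C(z₀, R), (z - w)⁻¹ • f z)) := by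
      refine intervalIntegral.tendsto_integral_filter_of_dominated_convergence
        (fun θ => ‖deriv (circleMap z₀ R) θ‖ * (‖(circleMap z₀ R θ - w)⁻¹‖ * M))
        (.of_forall fun n => ?_) (.of_forall fun n => .of_forall fun θ _ => ?_) ?_
        (.of_forall fun θ _ => ?_)
      · exact (hcd.smul (hcinv.smul (hFcont n))).aestronglyMeasurable
      · rw [norm_smul, norm_smul]
        gcongr
        exact hbM n _ (hmem θ)
      · exact (hcd.norm.mul (hcinv.norm.mul continuous_const)).intervalIntegrable _ _
      · exact ((hlim _ (hball (hmem θ))).const_smul _).const_smul _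
    have h2 : ∀ n, (2 * Real.pi * Complex.I : ℂ)⁻¹ • ∮ z in C(z₀, R), (z - w)⁻¹ • F n z = F n w :=
      fun n => by
        rw [((hF n).mono hball).circleIntegral_sub_inv_smul hw, smul_smul,
          inv_mul_cancel₀, one_smul]
        simp [Real.pi_ne_zero]
    refine tendsto_nhds_unique (hlim w (hball (Metric.ball_subset_closedBall hw))) ?_
    simpa only [h2] using h1.const_smul ((2 * Real.pi * Complex.I : ℂ)⁻¹)
  have := (hd.congr heq).differentiableAt (Metric.ball_mem_nhds z₀ (by exact_mod_cast hR))
  exact this.differentiableWithinAt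

namespace SturmLiouville

variable {S : SturmLiouville} {Λ c : ℝ}

theorem l2Near_of_bound {u : ℝ → ℂ} (hu : ContinuousOn u S.I) (hc : c ∈ S.I) {K : ℝ}
    (hK : ∀ x ∈ S.near .right c, ∫ t in c..x, S.dB u t ≤ K) : S.L2Near .right u := by
  refine ⟨c, hc, (integrableOn_near_right_of_bound hc (fun y hy =>
    intervalIntegrable_dB hu hc (near_right_subset_I hc hy)) S.ae_dB_nonneg hK).congr
      (.of_forall fun x => ?_)⟩
  simp only [dB]; ring

/-- The coefficient `m(z)` of the Weyl solution `φ - m s` exists off `[Λ, ∞)` and is holomorphic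
there. The functions `φ(z, y) / s(z, y)` are bounded as `y` tends to the endpoint, and each of
their cluster points gives a square integrable solution; in the limit point case there is only one
such solution. -/
theorem LimitPoint.exists_weyl_function (hlp : S.LimitPoint .right) (P : S.NonvanishingSol Λ c)
    (F : S.FundamentalSystem c) : ∃ m : ℂ → ℂ, DifferentiableOn ℂ m (slit Λ) ∧
      ∀ z ∈ slit Λ, S.L2Near .right fun x => F.φ z x - m z * F.s z x := by
  obtain ⟨y', -, hy', hy'lim⟩ := exists_seq_near_right P.mem
  obtain ⟨n₀, hn₀⟩ := hy'lim c (self_mem_near_right P.mem)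
  set y₀ := y' n₀
  have hy₀ : y₀ ∈ S.near .right c := hy' n₀
  have hy₀I := P.near_subset hy₀
  obtain ⟨y, hmono, hy, hylim⟩ := exists_seq_near_right hy₀I
  have hyc : ∀ n, y n ∈ S.near .right c := fun n => near_right_antitone hn₀.le (hy n)
  obtain ⟨K, K', hKc, hK⟩ := P.exists_weyl_bound F hy₀ hn₀
  set M : ℕ → ℂ → ℂ := fun n z => F.φ z (y n) / F.s z (y n) with hM
  have hsol : ∀ z k, S.IsSol z (fun x => F.φ z x - k * F.s z x)
      (fun x => F.φ₁ z x - k * F.s₁ z x) := fun z k =>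
    (F.φ_sol z).sub ((F.s_sol z).const_mul k)
  have hcluster : ∀ z ∈ slit Λ, ∀ k, MapClusterPt k Filter.atTop (fun n => M n z) →
      S.L2Near .right fun x => F.φ z x - k * F.s z x := by
    intro z hz k hk
    refine l2Near_of_bound (hsol z k).continuousOn P.mem (K := 2 * K' z + 2) fun x hx => ?_
    have hxI := P.near_subset hx
    have iB : ∀ {u : ℝ → ℂ}, ContinuousOn u S.I → IntervalIntegrable (S.dB u) volume c x :=
      fun hu => intervalIntegrable_dB hu P.mem hxI
    set T := ∫ t in c..x, S.dB (F.s z) t with hT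
    have hT0 : 0 ≤ T := integral_dB_nonneg P.mem hxI hx.1
    have hev : ∀ᶠ n in Filter.atTop, x < y n := by
      rcases le_total y₀ x with h | h
      · obtain ⟨n, hn⟩ := hylim x ⟨h, hx.2⟩
        exact Filter.eventually_atTop.2 ⟨n, fun m hm => hn.trans_le (hmono hm)⟩
      · obtain ⟨n, hn⟩ := hylim y₀ (self_mem_near_right hy₀I)
        exact Filter.eventually_atTop.2 ⟨n, fun m hm => h.trans_lt (hn.trans_le (hmono hm))⟩
    have hcl : ∃ᶠ n in Filter.atTop, ‖M n z - k‖ ^ 2 * T < 1 := by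
      refine hk.frequently (p := fun w => ‖w - k‖ ^ 2 * T < 1) ?_
      exact (isOpen_lt (by fun_prop) continuous_const).mem_nhds (by simp)
    obtain ⟨n, hn1, hn2⟩ := (hcl.and_eventually hev).exists
    have h1 : ∫ t in c..x, S.dB (fun x => F.φ z x - k * F.s z x) t ≤
        ∫ t in c..x, (2 * S.dB (fun x => F.φ z x - M n z * F.s z x) t +
          2 * ‖M n z - k‖ ^ 2 * S.dB (F.s z) t) := by
      refine intervalIntegral.integral_mono_ae_restrict hx.1 (iB (hsol z k).continuousOn)
        (((iB (hsol z (M n z)).continuousOn).const_mul 2).add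
          ((iB (F.s_sol z).continuousOn).const_mul _)) ?_
      refine (ae_restrict_iff' measurableSet_Icc).2 ?_
      filter_upwards [S.ae_r_pos] with t hr ht
      have hr := hr (S.ordConnected_I.out P.mem hxI ht)
      have e1 : F.φ z t - k * F.s z t =
          (F.φ z t - M n z * F.s z t) + (M n z - k) * F.s z t := by ring
      have e2 := norm_add_le (F.φ z t - M n z * F.s z t) ((M n z - k) * F.s z t)
      rw [norm_mul] at e2
      have e3 : ‖F.φ z t - k * F.s z t‖ ^ 2 ≤
          2 * ‖F.φ z t - M n z * F.s z t‖ ^ 2 + 2 * (‖M n z - k‖ * ‖F.s z t‖) ^ 2 := by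
        rw [e1]
        nlinarith [sq_nonneg (‖F.φ z t - M n z * F.s z t‖ - ‖M n z - k‖ * ‖F.s z t‖),
          norm_nonneg (F.φ z t - M n z * F.s z t + (M n z - k) * F.s z t)]
      simp only [dB]
      nlinarith
    rw [intervalIntegral.integral_add ((iB (hsol z (M n z)).continuousOn).const_mul 2)
      ((iB (F.s_sol z).continuousOn).const_mul _), intervalIntegral.integral_const_mul,
      intervalIntegral.integral_const_mul, ← hT] at h1
    have h2 : ∫ t in c..x, S.dB (fun x => F.φ z x - M n z * F.s z x) t ≤ K' z := by
      refine le_trans ?_ (hK z hz (y n) (hyc n) (hy n).1).2.2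
      have hynI := P.near_subset (hyc n)
      rw [← intervalIntegral.integral_add_adjacent_intervals
        (iB (hsol z (M n z)).continuousOn)
        (intervalIntegrable_dB (hsol z (M n z)).continuousOn hxI hynI)]
      linarith [integral_dB_nonneg (u := fun x => F.φ z x - M n z * F.s z x) hxI hynI hn2.le]
    linarith
  have huniq : ∀ z k k', S.L2Near .right (fun x => F.φ z x - k * F.s z x) →
      S.L2Near .right (fun x => F.φ z x - k' * F.s z x) → k = k' := by
    intro z k k' h h'
    have := hlp.wronskian_eq_zero (hsol z k) (hsol z k') h h' P.mem
    simp only [wronskian, F.φ_c, F.φ₁_c, F.s_c, F.s₁_c] at this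
    linear_combination this
  have hlim : ∀ z ∈ slit Λ, ∃ k, Filter.Tendsto (fun n => M n z) Filter.atTop (nhds k) ∧
      S.L2Near .right fun x => F.φ z x - k * F.s z x := by
    intro z hz
    have hcpt := isCompact_closedBall (0 : ℂ) (K z)
    have hmem : ∀ n, M n z ∈ Metric.closedBall (0 : ℂ) (K z) := fun n => by
      rw [mem_closedBall_zero_iff]; exact (hK z hz (y n) (hyc n) (hy n).1).2.1
    obtain ⟨k, -, hk⟩ := hcpt.exists_mapClusterPt (f := Filter.atTop) (u := fun n => M n z)
      (Filter.le_principal_iff.2 (Filter.mem_map.2 (Filter.univ_mem' hmem)))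
    refine ⟨k, hcpt.tendsto_nhds_of_unique_mapClusterPt (.of_forall hmem) fun k' _ hk' => ?_,
      hcluster z hz k hk⟩
    exact huniq z _ _ (hcluster z hz k' hk') (hcluster z hz k hk)
  choose! m hm using hlim
  refine ⟨m, differentiableOn_of_tendsto_of_bound (isOpen_slit Λ) (F := M) (K := K) (fun n => ?_)
    hKc (fun n z hz => (hK z hz (y n) (hyc n) (hy n).1).2.1) fun z hz => (hm z hz).1,
    fun z hz => (hm z hz).2⟩
  have hnI := P.near_subset (hyc n)
  exact (F.φ_entire _ hnI).differentiableOn.div (F.s_entire _ hnI).differentiableOn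
    fun z hz => (hK z hz (y n) (hyc n) (hy n).1).1

end SturmLiouville

/-! ### Principal solutions and the right endpoint -/

namespace SturmLiouville

variable {S : SturmLiouville} {Λ c : ℝ}

theorem ofReal_mem_slit {t : ℝ} (ht : t < Λ) : (t : ℂ) ∈ slit Λ := by
  rintro ⟨s, hs, hts⟩
  rw [Complex.ofReal_inj.1 hts] at ht
  exact ht.not_ge hs

theorem mem_slit_of_im_ne_zero {z : ℂ} (hz : z.im ≠ 0) : z ∈ slit Λ := by
  rintro ⟨s, -, rfl⟩
  exact hz (Complex.ofReal_im s)

theorem exists_gt_near_right (hc : c ∈ S.I) {Z : Set ℝ} (hZ : Z.Finite)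
    (hsub : Z ⊆ S.near .right c) : ∃ d ∈ S.near .right c, ∀ x ∈ Z, x < d := by
  obtain ⟨y, -, hy, hlim⟩ := exists_seq_near_right hc
  rcases Z.eq_empty_or_nonempty with rfl | hne
  · exact ⟨c, self_mem_near_right hc, by simp⟩
  · obtain ⟨x, hx, hmax⟩ := hZ.exists_maximalFor id Z hne
    obtain ⟨n, hn⟩ := hlim x (hsub hx)
    refine ⟨y n, hy n, fun x' hx' => lt_of_le_of_lt ?_ hn⟩
    exact le_of_not_gt fun h => (hmax hx' h.le).not_gt h

/-- A nontrivial real solution with finitely many zeros near the right endpoint is nonvanishing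
closer to the endpoint. -/
theorem exists_nonvanishingSol {u u₁ : ℝ → ℝ} (hc : c ∈ S.I) (hu : S.IsSol Λ u u₁)
    (hfin : {x : ℝ | x ∈ S.near .right c ∧ u x = 0}.Finite) :
    ∃ d ∈ S.near .right c, ∃ P : S.NonvanishingSol Λ d, P.w = u ∧ P.w₁ = u₁ := by
  obtain ⟨d, hd, hlt⟩ := exists_gt_near_right hc hfin fun x hx => hx.1
  exact ⟨d, hd, ⟨u, u₁, hu, near_right_subset_I hc hd, fun x hx h0 =>
    (hlt x ⟨near_right_antitone hd.1 hx, h0⟩).not_ge hx.1⟩, rfl, rfl⟩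

theorem NonoscillatoryFor.exists_nonvanishingSol (h : S.NonoscillatoryFor .right Λ) :
    ∃ d, Nonempty (S.NonvanishingSol Λ d) := by
  obtain ⟨c, hc, hfin⟩ := h
  obtain ⟨F⟩ := nonempty_fundamentalSystem hc
  have hu := (F.φ_sol Λ).re
  obtain ⟨d, -, P, -⟩ := SturmLiouville.exists_nonvanishingSol hc hu
    (hfin _ hu.isSolution ⟨c, hc, by simp [F.φ_c]⟩)
  exact ⟨d, ⟨P⟩⟩

namespace NonvanishingSol

variable (P : S.NonvanishingSol Λ c)

/-- The density `1 / (p w²)`. -/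
noncomputable def ρ (x : ℝ) : ℝ := 1 / (S.p x * P.w x ^ 2)

theorem ae_ρ_nonneg : ∀ᵐ x, x ∈ S.I → 0 ≤ P.ρ x := by
  filter_upwards [S.ae_p_pos] with x hp hx
  have := hp hx
  unfold ρ
  positivity

theorem intervalIntegrable_ρ {x y : ℝ} (hx : x ∈ S.near .right c) (hy : y ∈ S.near .right c) :
    IntervalIntegrable P.ρ volume x y := by
  have hsub := ordConnected_near_right.uIcc_subset hx hy
  have h := (intervalIntegrable_p_inv (P.near_subset hx) (P.near_subset hy)).mul_continuousOn
    (((P.continuousOn_w.mono (hsub.trans P.near_subset)).pow 2).inv₀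
      fun t ht => pow_ne_zero 2 (P.ne_zero t (hsub ht)))
  refine h.congr fun x _ => ?_
  simp [ρ, mul_comm]

/-- Reduction of order: `(g / w)' = W(w, g) / (p w²)`, with a constant Wronskian. -/
theorem quot_eq {g g₁ : ℝ → ℂ} (hg : S.IsSol (Λ : ℂ) g g₁) {y : ℝ} (hy : y ∈ S.near .right c) :
    g y / P.w y = g c / P.w c + P.W g g₁ c * (∫ t in c..y, P.ρ t : ℝ) := by
  have hJ := ordConnected_near_right (S := S) (c := c)
  have h0 : ∀ x ∈ S.near .right c, (P.w x : ℂ) ≠ 0 := fun x hx =>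
    Complex.ofReal_ne_zero.2 (P.ne_zero x hx)
  have hwi := (P.sol.ofReal.prim.mono P.near_subset).inv hJ h0
  have hq : IsPrimitiveOn (fun x => g x / P.w x) (fun x => P.W g g₁ c * (P.ρ x : ℂ))
      (S.near .right c) := by
    refine ((hg.prim.mono P.near_subset).mul hJ hwi).congr hJ
      (fun x _ => (div_eq_mul_inv _ _).symm) fun x hx => ?_
    have hW : P.W g g₁ c = P.W g g₁ x :=
      P.sol.ofReal.wronskian_const hg P.mem (P.near_subset hx)
    have := h0 x hx
    rw [hW]
    simp only [W, wronskian, Complex.coe_algebraMap, ρ, one_div, mul_inv, Complex.ofReal_mul,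
      Complex.ofReal_inv, Complex.ofReal_pow]
    field_simp
    ring
  have := (hq c (self_mem_near_right P.mem) y hy).2
  rw [intervalIntegral.integral_const_mul, intervalIntegral.integral_ofReal] at this
  rw [this]
  ring

theorem exists_bound_of_lintegral_ne_top
    (h : ∫⁻ x in S.near .right c, ENNReal.ofReal (P.ρ x) ≠ ⊤) :
    ∃ K, ∀ y ∈ S.near .right c, ∫ t in c..y, P.ρ t ≤ K := by
  have hp := S.aemeasurable_p.mono_measure (Measure.restrict_mono P.near_subset le_rfl)
  have hw : AEMeasurable P.w (volume.restrict (S.near .right c)) :=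
    (P.continuousOn_w.mono P.near_subset).aemeasurable measurableSet_near_right
  have hint : IntegrableOn P.ρ (S.near .right c) := by
    refine ⟨((hp.mul (hw.pow_const 2)).const_div 1).aestronglyMeasurable, ?_⟩
    rw [hasFiniteIntegral_iff_ofReal]
    · exact h.lt_top
    · refine (ae_restrict_iff' measurableSet_near_right).2 ?_
      filter_upwards [P.ae_ρ_nonneg] with t ht ht' using ht (P.near_subset ht')
  exact ⟨_, fun y hy => intervalIntegral_le_of_near_right P.mem hint P.ae_ρ_nonneg hy⟩

theorem l2Near_w_of_le {ψ : ℝ → ℂ} (hψ : ContinuousOn ψ S.I) (h2 : S.L2Near .right ψ) {d : ℝ}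
    (hd : d ∈ S.I) (hle : ∀ x ∈ S.near .right d, ‖(P.w x : ℂ)‖ ≤ ‖ψ x‖) :
    S.L2Near .right fun x => (P.w x : ℂ) :=
  l2Near_of_le (g := fun x => ‖ψ x‖ ^ 2) P.sol.ofReal.continuousOn hd (h2.integrableOn hψ hd)
    fun x hx => pow_le_pow_left₀ (norm_nonneg _) (hle x hx) 2

/-- In the limit point case, a square integrable nonvanishing solution is principal: otherwise
a second solution would be bounded by a multiple of it. -/
theorem lintegral_eq_top (hlp : S.LimitPoint .right)
    (h2 : S.L2Near .right fun x => (P.w x : ℂ)) :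
    ∫⁻ x in S.near .right c, ENNReal.ofReal (P.ρ x) = ⊤ := by
  by_contra hne
  obtain ⟨K, hK⟩ := P.exists_bound_of_lintegral_ne_top hne
  obtain ⟨F⟩ := nonempty_fundamentalSystem P.mem
  have hs := F.s_sol Λ
  have hw0 : (P.w c : ℂ) ≠ 0 :=
    Complex.ofReal_ne_zero.2 (P.ne_zero c (self_mem_near_right P.mem))
  have hW : P.W (F.s Λ) (F.s₁ Λ) c = P.w c := by simp [W, wronskian, F.s_c, F.s₁_c]
  refine hw0 (hW ▸ hlp.wronskian_eq_zero P.sol.ofReal hs h2 ?_ P.mem)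
  refine l2Near_of_le (g := fun x => (‖(P.w c : ℂ)‖ * K) ^ 2 * ‖(P.w x : ℂ)‖ ^ 2) hs.continuousOn
    P.mem ?_ fun x hx => ?_
  · exact ((h2.integrableOn P.sol.ofReal.continuousOn P.mem).const_mul
      ((‖(P.w c : ℂ)‖ * K) ^ 2)).congr (.of_forall fun x => by ring)
  · have hq := P.quot_eq hs hx
    rw [F.s_c, zero_div, zero_add, hW] at hq
    have hx0 : (P.w x : ℂ) ≠ 0 := Complex.ofReal_ne_zero.2 (P.ne_zero x hx)
    rw [div_eq_iff hx0] at hq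
    have hR0 : 0 ≤ ∫ t in c..x, P.ρ t := by
      refine intervalIntegral.integral_nonneg_of_ae_restrict hx.1 ?_
      refine (ae_restrict_iff' measurableSet_Icc).2 ?_
      filter_upwards [P.ae_ρ_nonneg] with t ht ht'
      exact ht (P.near_subset (Icc_subset_near_right (self_mem_near_right P.mem) hx ht'))
    rw [hq, norm_mul, norm_mul, Complex.norm_of_nonneg hR0, mul_pow]
    gcongr
    exact hK x hx

/-- In the limit point case, a principal solution has vanishing Wronskian with every square
integrable solution `ψ`: otherwise `ψ / w → ∞`, and `w` would be square integrable as well. -/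
theorem W_eq_zero (hlp : S.LimitPoint .right)
    (htop : ∫⁻ x in S.near .right c, ENNReal.ofReal (P.ρ x) = ⊤) {ψ ψ₁ : ℝ → ℂ}
    (hψ : S.IsSol (Λ : ℂ) ψ ψ₁) (h2 : S.L2Near .right ψ) : P.W ψ ψ₁ c = 0 := by
  by_contra hω
  set ω := P.W ψ ψ₁ c with hωdef
  have hω' : 0 < ‖ω‖ := norm_pos_iff.2 hω
  set K := (1 + ‖ψ c / P.w c‖) / ‖ω‖ with hKdef
  obtain ⟨d, hd, hdK⟩ : ∃ d ∈ S.near .right c, K < ∫ t in c..d, P.ρ t := by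
    by_contra! hle
    have := lintegral_near_right_le P.mem (fun y hy =>
      P.intervalIntegrable_ρ (self_mem_near_right P.mem) hy) P.ae_ρ_nonneg hle
    rw [htop] at this
    exact ENNReal.ofReal_ne_top (top_le_iff.1 this)
  refine hω (hlp.wronskian_eq_zero P.sol.ofReal hψ (P.l2Near_w_of_le hψ.continuousOn h2
    (P.near_subset hd) fun x hx => ?_) h2 P.mem)
  have hx' := near_right_antitone hd.1 hx
  have hR : K ≤ ∫ t in c..x, P.ρ t := by
    rw [← intervalIntegral.integral_add_adjacent_intervals
      (P.intervalIntegrable_ρ (self_mem_near_right P.mem) hd) (P.intervalIntegrable_ρ hd hx')]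
    have : 0 ≤ ∫ t in d..x, P.ρ t := by
      refine intervalIntegral.integral_nonneg_of_ae_restrict hx.1 ?_
      refine (ae_restrict_iff' measurableSet_Icc).2 ?_
      filter_upwards [P.ae_ρ_nonneg] with t ht ht'
      exact ht (P.near_subset (Icc_subset_near_right hd hx' ht'))
    linarith
  have hK0 : 0 ≤ K := by positivity
  have hq := P.quot_eq hψ hx'
  have hωR : 1 + ‖ψ c / P.w c‖ ≤ ‖ω * (∫ t in c..x, P.ρ t : ℝ)‖ := by
    rw [norm_mul, Complex.norm_of_nonneg (hK0.trans hR)]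
    rw [hKdef, div_le_iff₀ hω'] at hR
    linarith
  have h1 : 1 ≤ ‖ψ x / P.w x‖ := by
    rw [hq]
    have := norm_sub_le (ψ c / P.w c + ω * (∫ t in c..x, P.ρ t : ℝ)) (ψ c / P.w c)
    rw [add_sub_cancel_left] at this
    linarith
  have hx0 : 0 < ‖(P.w x : ℂ)‖ :=
    norm_pos_iff.2 (Complex.ofReal_ne_zero.2 (P.ne_zero x hx'))
  rwa [norm_div, one_le_div hx0] at h1

end NonvanishingSol

/-- The assertions relating Weyl–Titchmarsh and principal solutions at the endpoint `d` for
spectral parameters below `Λ`. -/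
def WeylPrincipal (S : SturmLiouville) (d : Endpoint) (Λ : ℝ) : Prop :=
  (∃ ψ : ℂ → ℝ → ℂ, S.IsWeylFamily d Λ ψ) ∧
  (∀ ψ : ℂ → ℝ → ℂ, S.IsWeylFamily d Λ ψ →
    ∀ t : ℝ, t < Λ → S.IsWeylTitchmarsh d (t : ℂ) (ψ (t : ℂ))) ∧
  ∀ t : ℝ, t < Λ →
    (∃ u : ℝ → ℝ, S.IsPrincipal d t u) ∧
    ∀ (ψ : ℝ → ℂ) (u : ℝ → ℝ), S.IsWeylTitchmarsh d (t : ℂ) ψ → S.IsPrincipal d t u →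
      ∃ k : ℂ, k ≠ 0 ∧ ∀ x ∈ S.I, ψ x = k * (u x : ℂ)

theorem weylPrincipal_right (hlp : S.LimitPoint .right) (P : S.NonvanishingSol Λ c) :
    S.WeylPrincipal .right Λ := by
  obtain ⟨F⟩ := nonempty_fundamentalSystem P.mem
  obtain ⟨m, hm, hm2⟩ := hlp.exists_weyl_function P F
  set ψ : ℂ → ℝ → ℂ := fun z x => F.φ z x - m z * F.s z x with hψdef
  set ψ₁ : ℂ → ℝ → ℂ := fun z x => F.φ₁ z x - m z * F.s₁ z x with hψ₁def
  have hψ : ∀ z, S.IsSol z (ψ z) (ψ₁ z) := fun z => (F.φ_sol z).sub ((F.s_sol z).const_mul (m z))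
  have hψc : ∀ z, ψ z c = 1 := fun z => by simp [hψdef, F.φ_c, F.s_c]
  have hψd : ∀ x ∈ S.I, DifferentiableOn ℂ (fun z => ψ z x) (slit Λ) := fun x hx =>
    (F.φ_entire x hx).differentiableOn.sub (hm.mul (F.s_entire x hx).differentiableOn)
  refine ⟨⟨ψ, fun z _ => ⟨(hψ z).isSolution, c, P.mem, by simp [hψc]⟩, fun z hz =>
    ⟨(hψ z).isSolution, ⟨c, P.mem, by simp [hψc]⟩, hm2 z (mem_slit_of_im_ne_zero hz)⟩, hψd⟩,
    fun χ hχ t ht => ?_, fun t ht => ⟨?_, fun χ u hχ hu => ?_⟩⟩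
  · obtain ⟨h1, h2, h3⟩ := hχ
    have htΛ := ofReal_mem_slit ht
    refine ⟨(h1 t htΛ).1, (h1 t htΛ).2, ?_⟩
    have hne : ∀ z : ℂ, z.im ≠ 0 → ∀ x ∈ S.I, χ z x = χ z c * ψ z x := by
      intro z hz x hx
      obtain ⟨hs, -, hL⟩ := h2 z hz
      obtain ⟨χ₁, hχ₁⟩ := isSolution_iff.1 hs
      have := hχ₁.eq_const_mul_of_wronskian_eq_zero (hψ z) P.mem (by simp [hψc])
        (hlp.wronskian_eq_zero hχ₁ (hψ z) hL (hm2 z (mem_slit_of_im_ne_zero hz)) P.mem) x hx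
      rwa [hψc, div_one] at this
    -- both sides are continuous in `z`, so the identity persists at the real point `t`
    have hreal : ∀ x ∈ S.I, χ t x = χ t c * ψ t x := by
      intro x hx
      have hnhds := (isOpen_slit Λ).mem_nhds htΛ
      have c1 := ((h3 x hx).differentiableAt hnhds).continuousAt
      have c2 := ((h3 c P.mem).differentiableAt hnhds).continuousAt.mul
        ((hψd x hx).differentiableAt hnhds).continuousAt
      have hseq : Filter.Tendsto (fun n : ℕ => (t : ℂ) + (1 / ((n : ℝ) + 1) : ℝ) * Complex.I)
          Filter.atTop (nhds t) := by
        have h0 := (Complex.continuous_ofReal.tendsto 0).comp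
          (tendsto_one_div_add_atTop_nhds_zero_nat (𝕜 := ℝ))
        simpa using (h0.mul_const Complex.I).const_add (t : ℂ)
      refine tendsto_nhds_unique (c1.tendsto.comp hseq) ((c2.tendsto.comp hseq).congr fun n => ?_)
      refine (hne _ ?_ x hx).symm
      have : (0 : ℝ) < 1 / ((n : ℝ) + 1) := by positivity
      change ((t : ℂ) + (1 / ((n : ℝ) + 1) : ℝ) * Complex.I).im ≠ 0
      rw [Complex.add_im, Complex.ofReal_im, zero_add, Complex.im_ofReal_mul, Complex.I_im, mul_one]
      exact this.ne'
    obtain ⟨χ₁, hχ₁⟩ := isSolution_iff.1 (h1 t htΛ).1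
    exact (hm2 t htΛ).of_lincomb (hm2 t htΛ) (hψ t).continuousOn (hψ t).continuousOn
      hχ₁.continuousOn (α := χ t c) (β := 0) fun x hx => by rw [hreal x hx]; simp [hψdef]
  · have htΛ := ofReal_mem_slit ht
    have hu := (hψ t).re
    have huC := hu.ofReal
    have hfin : {x : ℝ | x ∈ S.near .right c ∧ (ψ t x).re = 0}.Finite := by
      refine Set.Subsingleton.finite fun x hx y hy => ?_
      by_contra hxy
      wlog hlt : x < y generalizing x y
      · exact this y hy x hx (Ne.symm hxy) (lt_of_le_of_ne (not_lt.1 hlt) (Ne.symm hxy))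
      have := (P.eq_zero_of_two_zeros htΛ huC hx.1 hy.1 hlt (by simp [hx.2]) (by simp [hy.2])
        P.mem).1
      simp [hψc] at this
    obtain ⟨d, hd, Q, hQ, -⟩ := exists_nonvanishingSol P.mem hu hfin
    refine ⟨fun x => (ψ t x).re, hu.isSolution, d, Q.mem, fun x hx => ?_, ?_⟩
    · simpa only [hQ] using Q.ne_zero x hx
    · have := Q.lintegral_eq_top hlp (Q.l2Near_w_of_le (hψ t).continuousOn (hm2 t htΛ) P.mem
        fun x _ => by
          rw [hQ, Complex.norm_real]; exact Complex.abs_re_le_norm _)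
      simpa only [NonvanishingSol.ρ, hQ] using this
  · obtain ⟨hus, d, hd, hne, htop⟩ := hu
    obtain ⟨u₁, hu₁⟩ := isSolution_iff.1 hus
    obtain ⟨hs, ⟨x₀, hx₀, hχx₀⟩, hL⟩ := hχ
    obtain ⟨χ₁, hχ₁⟩ := isSolution_iff.1 hs
    let Q : S.NonvanishingSol t d := ⟨u, u₁, hu₁, hd, hne⟩
    have hW : wronskian (fun x => (u x : ℂ)) (fun x => (u₁ x : ℂ)) χ χ₁ d = 0 :=
      Q.W_eq_zero hlp htop hχ₁ hL
    have hprop := hχ₁.eq_const_mul_of_wronskian_eq_zero hu₁.ofReal hd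
      (Complex.ofReal_ne_zero.2 (hne d (self_mem_near_right hd))) (by
        simp only [wronskian] at hW ⊢
        linear_combination -hW)
    exact ⟨_, fun h => hχx₀ (by rw [hprop x₀ hx₀, h, zero_mul]), hprop⟩

end SturmLiouville

/-! ### Reflection -/

theorem IsPrimitiveOn.comp_neg {E : Type*} [NormedAddCommGroup E] [NormedSpace ℝ E] {f g : ℝ → E}
    {s : Set ℝ} (h : IsPrimitiveOn f g s) :
    IsPrimitiveOn (fun x => f (-x)) (fun x => -g (-x)) (Neg.neg ⁻¹' s) := fun x hx y hy => by
  obtain ⟨h1, h2⟩ := h (-x) hx (-y) hy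
  refine ⟨(by simpa using (IntervalIntegrable.iff_comp_neg (by simp)).1 h1 :
    IntervalIntegrable _ volume x y).neg, ?_⟩
  rw [intervalIntegral.integral_neg, intervalIntegral.integral_comp_neg,
    intervalIntegral.integral_symm, neg_neg, h2]

namespace SturmLiouville

theorem neg_preimage_Ioo (a b : EReal) :
    {x : ℝ | -b < x ∧ x < -a} = Neg.neg ⁻¹' {x : ℝ | a < x ∧ x < b} := by
  ext x
  simp only [mem_ofPred_eq, mem_preimage, EReal.coe_neg]
  rw [EReal.neg_lt_comm, EReal.lt_neg_comm, and_comm]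

theorem measurePreserving_neg_restrict {s : Set ℝ} (hs : MeasurableSet s) :
    MeasurePreserving (fun x : ℝ => -x) (volume.restrict (Neg.neg ⁻¹' s)) (volume.restrict s) :=
  (Measure.measurePreserving_neg volume).restrict_preimage hs

theorem locallyIntegrableOn_comp_neg {f : ℝ → ℝ} {s : Set ℝ} (hf : LocallyIntegrableOn f s) :
    LocallyIntegrableOn (fun x => f (-x)) (Neg.neg ⁻¹' s) := fun x hx => by
  obtain ⟨t, ht, hft⟩ := hf (-x) hx
  refine ⟨Neg.neg ⁻¹' t, ?_, ?_⟩
  · exact (continuous_neg.continuousWithinAt.tendsto_nhdsWithin (mapsTo_preimage _ s)) ht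
  · exact ((Measure.measurePreserving_neg volume).integrableOn_comp_preimage
      (Homeomorph.neg ℝ).measurableEmbedding).2 hft

/-- The Sturm–Liouville expression obtained by the substitution `x ↦ -x`. -/
noncomputable def reflect (S : SturmLiouville) : SturmLiouville where
  a := -S.b
  b := -S.a
  p x := S.p (-x)
  q x := S.q (-x)
  r x := S.r (-x)
  a_lt_b := EReal.neg_lt_neg_iff.2 S.a_lt_b
  aemeasurable_p := by
    rw [neg_preimage_Ioo]
    exact S.aemeasurable_p.comp_quasiMeasurePreserving
      (measurePreserving_neg_restrict S.isOpen_I.measurableSet).quasiMeasurePreserving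
  aemeasurable_q := by
    rw [neg_preimage_Ioo]
    exact S.aemeasurable_q.comp_quasiMeasurePreserving
      (measurePreserving_neg_restrict S.isOpen_I.measurableSet).quasiMeasurePreserving
  aemeasurable_r := by
    rw [neg_preimage_Ioo]
    exact S.aemeasurable_r.comp_quasiMeasurePreserving
      (measurePreserving_neg_restrict S.isOpen_I.measurableSet).quasiMeasurePreserving
  p_pos := by
    rw [neg_preimage_Ioo]
    exact (measurePreserving_neg_restrict
      S.isOpen_I.measurableSet).quasiMeasurePreserving.ae S.p_pos
  r_pos := by
    rw [neg_preimage_Ioo]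
    exact (measurePreserving_neg_restrict
      S.isOpen_I.measurableSet).quasiMeasurePreserving.ae S.r_pos
  locInt_p := by
    rw [neg_preimage_Ioo]; exact locallyIntegrableOn_comp_neg S.locInt_p
  locInt_q := by
    rw [neg_preimage_Ioo]; exact locallyIntegrableOn_comp_neg S.locInt_q
  locInt_r := by
    rw [neg_preimage_Ioo]; exact locallyIntegrableOn_comp_neg S.locInt_r

/-- The opposite endpoint. -/
def Endpoint.flip : Endpoint → Endpoint
  | .left => .right
  | .right => .left

theorem Endpoint.flip_flip (d : Endpoint) : d.flip.flip = d := by cases d <;> rfl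

variable {S : SturmLiouville} {d : Endpoint}

theorem reflect_reflect : S.reflect.reflect = S := by
  cases S
  simp [reflect]

theorem reflect_I : S.reflect.I = Neg.neg ⁻¹' S.I := neg_preimage_Ioo S.a S.b

theorem neg_mem_I {x : ℝ} (hx : x ∈ S.reflect.I) : -x ∈ S.I := by rwa [reflect_I] at hx

theorem neg_mem_reflect_I {x : ℝ} (hx : x ∈ S.I) : -x ∈ S.reflect.I := by
  rw [reflect_I, mem_preimage, neg_neg]; exact hx

theorem reflect_near (c : ℝ) :
    S.reflect.near d.flip c = Neg.neg ⁻¹' S.near d (-c) := by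
  cases d <;> ext x <;> simp only [near, reflect, Endpoint.flip, mem_ofPred_eq, mem_preimage,
    EReal.coe_neg]
  · rw [EReal.lt_neg_comm, neg_le_neg_iff, and_comm]
  · rw [EReal.neg_lt_comm, neg_le_neg_iff, and_comm]

theorem IsSol.reflect {𝕜 : Type*} [RCLike 𝕜] {z : 𝕜} {u u₁ : ℝ → 𝕜} (h : S.IsSol z u u₁) :
    S.reflect.IsSol z (fun x => u (-x)) (fun x => -u₁ (-x)) := by
  refine ⟨h.prim.comp_neg.congr ?_ (fun _ _ => rfl) (fun x _ => ?_) |>.mono reflect_I.subset,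
    (h.prim₁.comp_neg.const_mul (-1)).congr ?_ (fun x _ => by simp) (fun x _ => ?_)
      |>.mono reflect_I.subset⟩
  · rw [← reflect_I]; exact S.reflect.ordConnected_I
  · simp [SturmLiouville.reflect]
  · rw [← reflect_I]; exact S.reflect.ordConnected_I
  · simp [SturmLiouville.reflect]

theorem IsSolution.reflect {𝕜 : Type*} [RCLike 𝕜] {z : 𝕜} {u : ℝ → 𝕜} (h : S.IsSolution z u) :
    S.reflect.IsSolution z fun x => u (-x) := by
  obtain ⟨u₁, hu⟩ := isSolution_iff.1 h
  exact hu.reflect.isSolution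

theorem IsSolution.of_reflect {𝕜 : Type*} [RCLike 𝕜] {z : 𝕜} {u : ℝ → 𝕜}
    (h : S.reflect.IsSolution z u) : S.IsSolution z fun x => u (-x) := by
  have := h.reflect
  rwa [reflect_reflect] at this

theorem Nontrivial.reflect {𝕜 : Type*} [RCLike 𝕜] {u : ℝ → 𝕜} (h : S.Nontrivial u) :
    S.reflect.Nontrivial fun x => u (-x) := by
  obtain ⟨x, hx, hux⟩ := h
  exact ⟨-x, neg_mem_reflect_I hx, by simpa using hux⟩

theorem Nontrivial.of_reflect {𝕜 : Type*} [RCLike 𝕜] {u : ℝ → 𝕜} (h : S.reflect.Nontrivial u) :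
    S.Nontrivial fun x => u (-x) := by
  have := h.reflect
  rwa [reflect_reflect] at this

theorem L2Near.reflect {u : ℝ → ℂ} (h : S.L2Near d u) :
    S.reflect.L2Near d.flip fun x => u (-x) := by
  obtain ⟨c, hc, hint⟩ := h
  refine ⟨-c, neg_mem_reflect_I hc, ?_⟩
  rw [reflect_near, neg_neg]
  exact ((Measure.measurePreserving_neg volume).integrableOn_comp_preimage
    (Homeomorph.neg ℝ).measurableEmbedding).2 hint

theorem L2Near.of_reflect {u : ℝ → ℂ} (h : S.reflect.L2Near d.flip u) :
    S.L2Near d fun x => u (-x) := by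
  have := h.reflect
  rwa [reflect_reflect, Endpoint.flip_flip] at this

theorem IsWeylTitchmarsh.reflect {z : ℂ} {ψ : ℝ → ℂ} (h : S.IsWeylTitchmarsh d z ψ) :
    S.reflect.IsWeylTitchmarsh d.flip z fun x => ψ (-x) :=
  ⟨h.1.reflect, h.2.1.reflect, h.2.2.reflect⟩

theorem IsWeylTitchmarsh.of_reflect {z : ℂ} {ψ : ℝ → ℂ}
    (h : S.reflect.IsWeylTitchmarsh d.flip z ψ) : S.IsWeylTitchmarsh d z fun x => ψ (-x) :=
  ⟨h.1.of_reflect, h.2.1.of_reflect, h.2.2.of_reflect⟩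

theorem IsPrincipal.reflect {t : ℝ} {u : ℝ → ℝ} (h : S.IsPrincipal d t u) :
    S.reflect.IsPrincipal d.flip t fun x => u (-x) := by
  obtain ⟨hu, c, hc, hne, htop⟩ := h
  refine ⟨hu.reflect, -c, neg_mem_reflect_I hc, fun x hx => ?_, ?_⟩
  · rw [reflect_near, neg_neg] at hx
    exact hne _ hx
  · rw [reflect_near, neg_neg, ← htop]
    exact (Measure.measurePreserving_neg volume).setLIntegral_comp_preimage_emb
      (Homeomorph.neg ℝ).measurableEmbedding
      (fun x => ENNReal.ofReal (1 / (S.p x * u x ^ 2))) _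

theorem IsPrincipal.of_reflect {t : ℝ} {u : ℝ → ℝ} (h : S.reflect.IsPrincipal d.flip t u) :
    S.IsPrincipal d t fun x => u (-x) := by
  have := h.reflect
  rwa [reflect_reflect, Endpoint.flip_flip] at this

theorem IsWeylFamily.reflect {Λ : ℝ} {ψ : ℂ → ℝ → ℂ} (h : S.IsWeylFamily d Λ ψ) :
    S.reflect.IsWeylFamily d.flip Λ fun z x => ψ z (-x) :=
  ⟨fun z hz => ⟨(h.1 z hz).1.reflect, (h.1 z hz).2.reflect⟩, fun z hz => (h.2.1 z hz).reflect,
    fun x hx => h.2.2 (-x) (neg_mem_I hx)⟩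

theorem IsWeylFamily.of_reflect {Λ : ℝ} {ψ : ℂ → ℝ → ℂ} (h : S.reflect.IsWeylFamily d.flip Λ ψ) :
    S.IsWeylFamily d Λ fun z x => ψ z (-x) := by
  have := h.reflect
  rwa [reflect_reflect, Endpoint.flip_flip] at this

theorem NonoscillatoryFor.reflect {t : ℝ} (h : S.NonoscillatoryFor d t) :
    S.reflect.NonoscillatoryFor d.flip t := by
  obtain ⟨c, hc, hfin⟩ := h
  refine ⟨-c, neg_mem_reflect_I hc, fun u hu hu0 => ?_⟩
  refine ((hfin _ hu.of_reflect hu0.of_reflect).image Neg.neg).subset fun x hx => ?_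
  have hx1 := hx.1
  rw [reflect_near, neg_neg] at hx1
  exact ⟨-x, ⟨hx1, by rw [neg_neg]; exact hx.2⟩, neg_neg x⟩

theorem LimitPoint.reflect (h : S.LimitPoint d) : S.reflect.LimitPoint d.flip := by
  obtain ⟨z, hz, ψ, hψ, huniq⟩ := h
  refine ⟨z, hz, _, hψ.reflect, fun φ hφ hφ2 => ?_⟩
  obtain ⟨k, hk⟩ := huniq _ hφ.of_reflect hφ2.of_reflect
  exact ⟨k, fun x hx => by simpa using hk (-x) (neg_mem_I hx)⟩

theorem WeylPrincipal.reflect {Λ : ℝ} (h : S.WeylPrincipal d Λ) :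
    S.reflect.WeylPrincipal d.flip Λ := by
  obtain ⟨⟨ψ, hψ⟩, h2, h3⟩ := h
  refine ⟨⟨_, hψ.reflect⟩, fun χ hχ t ht => ?_, fun t ht => ⟨?_, fun χ u hχ hu => ?_⟩⟩
  · simpa using (h2 _ hχ.of_reflect t ht).reflect
  · obtain ⟨u, hu⟩ := (h3 t ht).1
    exact ⟨_, hu.reflect⟩
  · obtain ⟨k, hk, hk'⟩ := (h3 t ht).2 _ _ hχ.of_reflect hu.of_reflect
    exact ⟨k, hk, fun x hx => by simpa using hk' (-x) (neg_mem_I hx)⟩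

theorem exists_weylPrincipal (hnonosc : S.Nonoscillatory d) (hlp : S.LimitPoint d) :
    ∃ Λ, S.WeylPrincipal d Λ := by
  obtain ⟨Λ, hΛ⟩ := hnonosc
  refine ⟨Λ, ?_⟩
  cases d
  · obtain ⟨c, ⟨P⟩⟩ := NonoscillatoryFor.exists_nonvanishingSol hΛ.reflect
    have := (weylPrincipal_right hlp.reflect P).reflect
    rwa [reflect_reflect] at this
  · obtain ⟨c, ⟨P⟩⟩ := hΛ.exists_nonvanishingSol
    exact weylPrincipal_right hlp P

end SturmLiouville

theorem theorem2p13 (S : SturmLiouville) (d : SturmLiouville.Endpoint)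
    (hnonosc : S.Nonoscillatory d) (hlp : S.LimitPoint d) :
    ∃ Λ : ℝ,
      -- Weyl–Titchmarsh solutions extend analytically to real parameters below `Λ`,
      -- and the extended solutions are again Weyl–Titchmarsh solutions
      (∃ ψ : ℂ → ℝ → ℂ, S.IsWeylFamily d Λ ψ) ∧
      (∀ ψ : ℂ → ℝ → ℂ, S.IsWeylFamily d Λ ψ →
        ∀ t : ℝ, t < Λ → S.IsWeylTitchmarsh d (t : ℂ) (ψ (t : ℂ))) ∧
      ∀ t : ℝ, t < Λ →
        (∃ u : ℝ → ℝ, S.IsPrincipal d t u) ∧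
        ∀ (ψ : ℝ → ℂ) (u : ℝ → ℝ), S.IsWeylTitchmarsh d (t : ℂ) ψ → S.IsPrincipal d t u →
          (∀ x ∈ S.I, ∀ x₀ ∈ S.I,
            (∀ y ∈ S.I, (ψ y = 0 ∨ u y = 0) → d.Beyond x y ∧ d.Beyond x₀ y) →
              ψ x * (ψ x₀)⁻¹ = (u x : ℂ) * (u x₀ : ℂ)⁻¹) ∧
          ∃ k : ℂ, k ≠ 0 ∧ ∀ x ∈ S.I, ψ x = k * (u x : ℂ) := by
  obtain ⟨Λ, h1, h2, h3⟩ := S.exists_weylPrincipal hnonosc hlp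
  refine ⟨Λ, h1, h2, fun t ht => ⟨(h3 t ht).1, fun ψ u hψ hu => ?_⟩⟩
  obtain ⟨k, hk, hk'⟩ := (h3 t ht).2 ψ u hψ hu
  refine ⟨fun x hx x₀ hx₀ _ => ?_, k, hk, hk'⟩
  rw [hk' x hx, hk' x₀ hx₀, mul_inv, mul_mul_mul_comm, mul_inv_cancel₀ hk, one_mul]
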